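/- **Setting.** Let $\mathcal A\subseteq B(H)$ be a von Neumann algebra, let $\phi$ be a normal state on $\mathcal A$ that is non-degenerated, i.e. $a=0$ whenever $\phi(bac)=0$ for all $b,c\in\mathcal A$, and let $(x_i)_{i\in\mathbb N}$ be a sequence of selfadjoint elements of $\mathcal A$ such that $\mathcal A$ is the closure in the weak operator topology (WOT) of the non-unital algebra generated by $(x_i)_{i\in\mathbb N}$. The non-unital tail algebra is $\mathcal T=\bigcap_{n} W^*\{x_k: k\ge n\}$, where $W^*\{x_k:k\ge n\}$ is the WOT closure of the non-unital algebra generated by $\{x_k:k\ge n\}$. **Invariance.** Let $B_s(n)$ be the universal unital $C^*$-algebra generated by orthogonal projections $u_{i,j}$ ($1\le i,j\le n$) and $\mathbf P$ such that $u_{i,k}u_{i,l}=0=u_{k,i}u_{l,i}$ for $k\ne l$ and $\mathbf P=\sum_{k=1}^n u_{k,i}\mathbf P$ for every $i$, and let $\mathcal B_s(n)=\mathbf P B_s(n)\mathbf P$, with identity $\mathbf P$. The linear coaction of $\mathcal B_s(n)$ is the linear map $\mathsf L_n:\mathbb C\langle X_1,\dots,X_n\rangle\to\mathbb C\langle X_1,\dots,X_n\rangle\otimes\mathcal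 B_s(n)$ with $$\mathsf L_n(X_{i_1}\cdots X_{i_k})=\sum_{j_1,\dots,j_k=1}^n X_{j_1}\cdots X_{j_k}\otimes\mathbf P u_{j_1,i_1}\cdots u_{j_k,i_k}\mathbf P .$$ The joint distribution of $(x_i)$ satisfies the invariance conditions associated with these coactions if for all $n$ and all $p\in\mathbb C\langle X_1,\dots,X_n\rangle$ one has $\mu_n(p)\mathbf P=(\mu_n\otimes\mathrm{id})(\mathsf L_n p)$, where $\mu_n(p)=\phi(p(x_1,\dots,x_n))$. **Operator valued notions.** A conditional expectation from $\mathcal A$ onto $\mathcal T$ is a linear map $E:\mathcal A\to\mathcal T$ with $E[\mathcal A]=\mathcal T$ and $E[b_1ab_2]=b_1E[a]b_2$ for $a\in\mathcal A$, $b_1,b_2\in\mathcal T$; it is normal if it is WOT continuous on norm-bounded sets. Let $\mathcal T\langle X\rangle$ be the algebra freely generated by $\mathcal T$ and an indeterminate $X$, and let $\mathcal T\langle X\rangle_0$ be the linear span in it of the monomials $b_0Xb_1X\cdots Xb_n$ with $n\ge1$ and $b_k\in\mathcal T\cup\mathbb C1$. The sequence is identically distributed with respect to $E$ if $E[p(x_i)]=E[p(x_j)]$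 for all $i,j$ and all $p\in\mathcal T\langle X\rangle$, and boolean independent with respect to $E$ if $$E[p_1(x_{i_1})\cdots p_n(x_{i_n})]=E[p_1(x_{i_1})]\cdots E[p_n(x_{i_n})]$$ for all $n\ge1$, all indices with $i_1\ne i_2\ne\cdots\ne i_n$ (consecutive indices differ) and all $p_1,\dots,p_n\in\mathcal T\langle X\rangle_0$. **Theorem.** The following are equivalent: a) The joint distribution of $(x_i)_{i\in\mathbb N}$ satisfies the invariance conditions associated with the linear coactions of the $\mathcal B_s(n)$, $n\in\mathbb N$. b) There is a $\phi$-preserving (that is, $\phi\circ E=\phi$) normal conditional expectation $E$ from $\mathcal A$ onto the non-unital tail algebra $\mathcal T$ with respect to which the sequence $(x_i)_{i\in\mathbb N}$ is identically distributed and boolean independent. -/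

import Mathlib

open scoped ENNReal TensorProduct ComplexOrder

noncomputable section

namespace BooleanDeFinetti

universe u v w

/-! ### Noncommutative polynomials and joint distributions

`FreeAlgebra ℂ ι` is the algebra `ℂ⟨X_i | i ∈ ι⟩` of noncommutative polynomials. -/

/-- The joint distribution of `(x_i)` with respect to `φ`: the linear functional
`p ↦ φ (p (x))` on noncommutative polynomials. -/
def jointDistribution {ι : Type v} {A : Type w} [Ring A] [Algebra ℂ A]
    (φ : A →ₗ[ℂ] ℂ) (x : ι → A) : FreeAlgebra ℂ ι →ₗ[ℂ] ℂ :=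
  φ ∘ₗ (FreeAlgebra.lift ℂ x).toLinearMap

/-! ### The universal C⋆-algebra `B_s(n)` and its corner `𝓑_s(n) = 𝐏 B_s(n) 𝐏` -/

/-- The defining relations of `B_s(n)`. -/
structure BsRelations {n : ℕ} {A : Type w} [Ring A] [StarRing A]
    (u : Fin n → Fin n → A) (P : A) : Prop where
  isStarProjection_u : ∀ i j, IsStarProjection (u i j)
  isStarProjection_P : IsStarProjection P
  row_orthogonal : ∀ i k l, k ≠ l → u i k * u i l = 0
  column_orthogonal : ∀ i k l, k ≠ l → u k i * u l i = 0
  invariant : ∀ i, P = ∑ k, u k i * P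

/-- A realization of the relations of `B_s(n)` in a nonzero unital C⋆-algebra. C⋆-algebras in
`Type` suffice: a C⋆-algebra generated by finitely many elements has at most continuum many
elements. -/
structure BsRep (n : ℕ) : Type 1 where
  carrier : Type
  [cstarAlgebra : CStarAlgebra carrier]
  [nontrivial : Nontrivial carrier]
  u : Fin n → Fin n → carrier
  P : carrier
  relations : BsRelations u P

attribute [instance] BsRep.cstarAlgebra BsRep.nontrivial

/-- The `ℓ^∞`-product of the targets of all realizations. -/
abbrev BsProduct (n : ℕ) : Type 1 := lp (fun R : BsRep n => R.carrier) ∞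

theorem memℓp_of_isStarProjection {n : ℕ} (f : ∀ R : BsRep n, R.carrier)
    (hf : ∀ R, IsStarProjection (f R)) : Memℓp f ∞ :=
  memℓp_infty ⟨1, by rintro _ ⟨R, rfl⟩; exact (hf R).norm_le⟩

/-- The family of all the `u_{i,j}`. -/
def BsProduct.u (n : ℕ) (i j : Fin n) : BsProduct n :=
  ⟨fun R => R.u i j,
    memℓp_of_isStarProjection _ fun R => R.relations.isStarProjection_u i j⟩

/-- The family of all the `𝐏`. -/
def BsProduct.P (n : ℕ) : BsProduct n :=
  ⟨fun R => R.P, memℓp_of_isStarProjection _ fun R => R.relations.isStarProjection_P⟩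

/-- `ℓ^∞`-products of unital C⋆-algebras are unital C⋆-algebras. -/
instance (n : ℕ) : CStarAlgebra (BsProduct n) where

/-- The closed unital ⋆-subalgebra generated by the families of the generators in the product of
all realizations. -/
def bsSubalgebra (n : ℕ) : StarSubalgebra ℂ (BsProduct n) :=
  (StarAlgebra.adjoin ℂ
    (insert (BsProduct.P n) (Set.range fun ij : Fin n × Fin n => BsProduct.u n ij.1 ij.2)))
      |>.topologicalClosure

instance (n : ℕ) : CStarAlgebra (bsSubalgebra n) :=
  StarSubalgebra.cstarAlgebra (bsSubalgebra n)
    (h_closed := StarSubalgebra.isClosed_topologicalClosure _)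

/-- `B_s(n)`, the universal unital C⋆-algebra generated by projections `u_{i,j}` and `𝐏` subject
to `BsRelations`. -/
def Bs (n : ℕ) : Type 1 := bsSubalgebra n

instance (n : ℕ) : CStarAlgebra (Bs n) := inferInstanceAs (CStarAlgebra (bsSubalgebra n))

namespace Bs

variable (n : ℕ)

/-- The standard generators `u_{i,j}` of `B_s(n)`. -/
def u (i j : Fin n) : Bs n :=
  ⟨BsProduct.u n i j, StarSubalgebra.le_topologicalClosure _
    (StarAlgebra.subset_adjoin ℂ _ (Set.mem_insert_of_mem _ ⟨(i, j), rfl⟩))⟩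

/-- The invariant projection `𝐏` of `B_s(n)`. -/
def P : Bs n :=
  ⟨BsProduct.P n, StarSubalgebra.le_topologicalClosure _
    (StarAlgebra.subset_adjoin ℂ _ (Set.mem_insert _ _))⟩

theorem star_P : star (P n) = P n :=
  Subtype.ext <| Subtype.ext <| funext fun R => R.relations.isStarProjection_P.2

theorem P_mul_P : P n * P n = P n :=
  Subtype.ext <| Subtype.ext <| funext fun R => R.relations.isStarProjection_P.1

end Bs

/-- The boolean permutation quantum semigroup `𝓑_s(n) = 𝐏 B_s(n) 𝐏`. -/
def BooleanBs (n : ℕ) : NonUnitalStarSubalgebra ℂ (Bs n) where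
  carrier := {a | ∃ b : Bs n, a = Bs.P n * b * Bs.P n}
  zero_mem' := ⟨0, by simp⟩
  add_mem' := by
    rintro _ _ ⟨b, rfl⟩ ⟨c, rfl⟩
    exact ⟨b + c, by rw [mul_add, add_mul]⟩
  mul_mem' := by
    rintro _ _ ⟨b, rfl⟩ ⟨c, rfl⟩
    exact ⟨b * Bs.P n * (Bs.P n * c), by simp only [mul_assoc]⟩
  smul_mem' := by
    rintro r _ ⟨b, rfl⟩
    exact ⟨r • b, by rw [mul_smul_comm, smul_mul_assoc]⟩
  star_mem' := by
    rintro _ ⟨b, rfl⟩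
    exact ⟨star b, by simp only [star_mul, Bs.star_P, mul_assoc]⟩

namespace BooleanBs

variable (n : ℕ)

/-- The compression `b ↦ 𝐏 b 𝐏` from `B_s(n)` onto `𝓑_s(n)`. -/
def compress : Bs n →ₗ[ℂ] BooleanBs n where
  toFun b := ⟨Bs.P n * b * Bs.P n, b, rfl⟩
  map_add' b c := Subtype.ext (by simp [mul_add, add_mul])
  map_smul' r b := Subtype.ext (by simp)

/-- The projection `𝐏`, which is the identity of `𝓑_s(n)`. -/
def unit : BooleanBs n := ⟨Bs.P n, 1, by rw [mul_one, Bs.P_mul_P]⟩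

end BooleanBs

/-- The linear coaction of `𝓑_s(n)` on `ℂ⟨X_1, …, X_n⟩`, the linear map with
`X_{i_1} ⋯ X_{i_k} ↦ ∑_{j_1, …, j_k} X_{j_1} ⋯ X_{j_k} ⊗ 𝐏 u_{j_1,i_1} ⋯ u_{j_k,i_k} 𝐏`. -/
def linearCoaction (n : ℕ) :
    FreeAlgebra ℂ (Fin n) →ₗ[ℂ] FreeAlgebra ℂ (Fin n) ⊗[ℂ] BooleanBs n :=
  (FreeAlgebra.basisFreeMonoid ℂ (Fin n)).constr ℂ fun i =>
    ∑ j : Fin i.toList.length → Fin n,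
      (List.ofFn fun t => FreeAlgebra.ι ℂ (j t)).prod ⊗ₜ[ℂ]
        BooleanBs.compress n (List.ofFn fun t => Bs.u n (j t) (i.toList.get t)).prod

/-- The joint distribution of `(x_i)` satisfies the invariance conditions associated with the
linear coactions of the `𝓑_s(n)`: for every `n`, with `μ` the joint distribution of the first `n`
variables, `μ(p) 𝐏 = (μ ⊗ id)(L_n p)` for all `p ∈ ℂ⟨X_1, …, X_n⟩`. -/
def IsBooleanInvariant {A : Type w} [Ring A] [Algebra ℂ A]
    (φ : A →ₗ[ℂ] ℂ) (x : ℕ → A) : Prop :=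
  ∀ (n : ℕ) (p : FreeAlgebra ℂ (Fin n)),
    jointDistribution φ (fun i : Fin n => x i) p • BooleanBs.unit n =
      TensorProduct.lid ℂ (BooleanBs n)
        ((jointDistribution φ (fun i : Fin n => x i)).rTensor (BooleanBs n)
          (linearCoaction n p))

/-! ### `𝓑`-polynomials -/

/-- The relations making `b ↦ some b` a homomorphism of (non-unital) complex algebras; the
generator `none` is the indeterminate. -/
inductive BPolyRel (B : Type w) [NonUnitalRing B] [Module ℂ B] :
    FreeAlgebra ℂ (Option B) → FreeAlgebra ℂ (Option B) → Prop
  | add (a b : B) : BPolyRel B (FreeAlgebra.ι ℂ (some (a + b)))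
      (FreeAlgebra.ι ℂ (some a) + FreeAlgebra.ι ℂ (some b))
  | smul (c : ℂ) (a : B) : BPolyRel B (FreeAlgebra.ι ℂ (some (c • a)))
      (c • FreeAlgebra.ι ℂ (some a))
  | mul (a b : B) : BPolyRel B (FreeAlgebra.ι ℂ (some (a * b)))
      (FreeAlgebra.ι ℂ (some a) * FreeAlgebra.ι ℂ (some b))

/-- The unital algebra `𝓑⟨X⟩` freely generated by the (possibly non-unital) algebra `𝓑` and an
indeterminate `X`. -/
abbrev BPoly (B : Type w) [NonUnitalRing B] [Module ℂ B] : Type w :=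
  RingQuot (BPolyRel B)

namespace BPoly

variable (B : Type w) [NonUnitalRing B] [Module ℂ B]

/-- The indeterminate. -/
def X : BPoly B := RingQuot.mkAlgHom ℂ (BPolyRel B) (FreeAlgebra.ι ℂ none)

/-- The inclusion of the coefficients. -/
def C (b : B) : BPoly B := RingQuot.mkAlgHom ℂ (BPolyRel B) (FreeAlgebra.ι ℂ (some b))

/-- The admissible coefficients of a monomial: `𝓑 ∪ ℂ 1_X`. -/
def coefficients : Set (BPoly B) := Set.range (C B) ∪ Set.range fun c : ℂ => c • (1 : BPoly B)

/-- `𝓑⟨X⟩₀`, the polynomials without constant term: the linear span of the monomials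
`b_0 X b_1 X b_2 ⋯ X b_n` with `n ≥ 1` and `b_k ∈ 𝓑 ∪ ℂ 1_X`. -/
def withoutConstantTerm : Submodule ℂ (BPoly B) :=
  Submodule.span ℂ {p | ∃ b₀ ∈ coefficients B, ∃ bs : List (BPoly B), bs ≠ [] ∧
    (∀ b ∈ bs, b ∈ coefficients B) ∧ p = b₀ * (bs.map fun b => X B * b).prod}

variable {B}

/-- The evaluation `p ↦ p(x)` of `𝓑`-polynomials, where `f` maps the coefficients to the algebra
that `x` belongs to. -/
def eval {A : Type v} [Ring A] [Algebra ℂ A] (f : B →ₙₐ[ℂ] A) (x : A) : BPoly B →ₐ[ℂ] A :=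
  RingQuot.liftAlgHom ℂ ⟨FreeAlgebra.lift ℂ fun o => o.elim x f, by
    intro p q h
    cases h <;> simp⟩

end BPoly

/-! ### Operator valued probability spaces -/

section OperatorValued

variable {A : Type w} [Ring A] [Algebra ℂ A]

/-- `p(x) ∈ A` for a polynomial `p` with coefficients in the subalgebra `B` of `A`. -/
def evalAt (B : NonUnitalSubalgebra ℂ A) (x : A) (p : BPoly B) : A :=
  BPoly.eval (NonUnitalSubalgebraClass.subtype B) x p

/-- `E` is a conditional expectation from `A` onto the (possibly non-unital) subalgebra `B`: a
surjective `B`-`B` bimodule linear map. -/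
structure IsConditionalExpectation (B : NonUnitalSubalgebra ℂ A) (E : A →ₗ[ℂ] B) : Prop where
  bimodule : ∀ (b₁ b₂ : B) (a : A), E (b₁ * a * b₂) = b₁ * E a * b₂
  surjective : Function.Surjective E

/-- The `x_i` are identically distributed with respect to `E`. -/
def IsIdenticallyDistributed {ι : Type v} (B : NonUnitalSubalgebra ℂ A) (E : A →ₗ[ℂ] B)
    (x : ι → A) : Prop :=
  ∀ (i j : ι) (p : BPoly B), E (evalAt B (x i) p) = E (evalAt B (x j) p)

/-- The `x_i` are boolean independent with respect to `E`:
`E[p_1(x_{i_1}) ⋯ p_n(x_{i_n})] = E[p_1(x_{i_1})] ⋯ E[p_n(x_{i_n})]` for `n ≥ 1`,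
`i_1 ≠ i_2 ≠ ⋯ ≠ i_n` and `p_1, …, p_n ∈ B⟨X⟩₀`; the list consists of the pairs `(i_k, p_k)`. -/
def IsBooleanIndependent {ι : Type v} (B : NonUnitalSubalgebra ℂ A) (E : A →ₗ[ℂ] B)
    (x : ι → A) : Prop :=
  ∀ l : List (ι × BPoly B), l ≠ [] → l.IsChain (fun q r => q.1 ≠ r.1) →
    (∀ q ∈ l, q.2 ∈ BPoly.withoutConstantTerm B) →
    (E (l.map fun q => evalAt B (x q.1) q.2).prod : A) =
      (l.map fun q => (E (evalAt B (x q.1) q.2) : A)).prod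

/-- `φ` is non-degenerated: `x = 0` whenever `φ(a x b) = 0` for all `a`, `b`. -/
def IsNondegenerate (φ : A →ₗ[ℂ] ℂ) : Prop :=
  ∀ x : A, (∀ a b : A, φ (a * x * b) = 0) → x = 0

end OperatorValued

/-! ### von Neumann algebras -/

section VonNeumann

variable {H : Type u} [NormedAddCommGroup H] [InnerProductSpace ℂ H] [CompleteSpace H]
  (S : VonNeumannAlgebra H)

/-- The inclusion of a von Neumann algebra in `B(H)` with the weak operator topology. -/
def toWOT : S.toStarSubalgebra →ₐ[ℂ] (H →WOT[ℂ] H) :=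
  (ContinuousLinearMapWOT.algEquiv (𝕜₁ := ℂ) (E := H) ℂ).symm.toAlgHom.comp
    S.toStarSubalgebra.subtype.toAlgHom

/-- The weak operator topology on a von Neumann algebra. -/
abbrev wot : TopologicalSpace S.toStarSubalgebra :=
  TopologicalSpace.induced (toWOT S) inferInstance

/-- A map `f` on a von Neumann algebra is normal if it is continuous for the weak operator topology
on norm-bounded sets. (For a linear functional, and for a linear map into `B(H)` with the weak
operator topology, this is ultraweak continuity.) -/
def IsNormal {Y : Type v} [TopologicalSpace Y] (f : S.toStarSubalgebra → Y) : Prop :=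
  ∀ r : ℝ, @ContinuousOn _ _ (wot S) _ f {a | ‖a‖ ≤ r}

/-- `φ` is a normal state. -/
structure IsNormalState (φ : S.toStarSubalgebra →ₗ[ℂ] ℂ) : Prop where
  map_one : φ 1 = 1
  nonneg : ∀ a, 0 ≤ φ (star a * a)
  normal : IsNormal S φ

variable {S}

/-- The WOT closure of a non-unital subalgebra (in `S`, equivalently in `B(H)`). -/
def wotClosure (C : NonUnitalSubalgebra ℂ S.toStarSubalgebra) :
    NonUnitalSubalgebra ℂ S.toStarSubalgebra :=
  ((C.map (toWOT S)).topologicalClosure).comap (toWOT S)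

/-- The non-unital tail algebra `𝒯 = ⋂_n W*{x_k | k ≥ n}`, where `W*{x_k | k ≥ n}` is the WOT
closure of the non-unital algebra generated by `{x_k | k ≥ n}`. -/
def tailAlgebra (x : ℕ → S.toStarSubalgebra) : NonUnitalSubalgebra ℂ S.toStarSubalgebra :=
  ⨅ n : ℕ, wotClosure (NonUnitalAlgebra.adjoin ℂ (x '' Set.Ici n))

end VonNeumann

end BooleanDeFinetti

end

open BooleanDeFinetti

noncomputable section

namespace BooleanDeFinetti

open Filter Topology
open scoped InnerProductSpace

set_option linter.unusedSectionVars false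

universe u v w

/-! Both conditions say that a moment φ(x_{i_1} ⋯ x_{i_k}) depends only on which neighbouring
indices agree (`IsPatternInvariant`).

Invariance gives this through a realization of the relations of B_s(n) by rank one projections
(`exists_bsVectors`). There the coefficient ⟪v, u_{j_1,i_1} ⋯ u_{j_k,i_k} v⟫ sees only the pattern
of i, hence so does the moment of i, which is a sum over j of such coefficients times moments of j.

From pattern invariance to the expectation: nondegeneracy makes the GNS representation π faithful,
hence isometric. The shift of indices preserves the Gram matrix of the vectors x_w ξ, so it extends
to a contraction. Let Q be the projection onto its fixed vectors; by the mean ergodic theorem, Q in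
a matrix coefficient pushes the letters to its right off to infinity. Hence Q π(w) Q is a weak limit
of shifts of the word w and lies in π(𝒯), while a tail element is a limit of words with far letters
and satisfies Q π(t) Q = π(t). The expectation is π(E a) = Q π(a) Q. Boolean independence comes from
x_i Q x_j = x_i x_j for i ≠ j (`mul_mul_eq`), identical distribution from Q x_i^k Q = Q x_j^k Q
(`conj_pow_eq`). Normality is continuity on bounded sets only, so elements of weak closures have to
be reached by bounded filters: this is the role of Kaplansky density.

Conversely, boolean independence writes E of a word as a sum over interval partitions into constant
blocks, weighted by boolean cumulants (`booleanMoment_add_sum`). The relations u_{a',a} u_{a',b} =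
δ_{a,b} u_{a',a} and ∑ u_{a',a} 𝐏 = 𝐏 reproduce this sum term by term (`sum_booleanMoment_smul`). -/

/-! ### Kaplansky density -/

section Kaplansky

variable {H : Type u} [NormedAddCommGroup H] [InnerProductSpace ℂ H] [CompleteSpace H]

/-- `a` is in the closure of `M` for the strong operator topology. -/
def InStrongClosure (M : Set (H →L[ℂ] H)) (a : H →L[ℂ] H) : Prop :=
  ∀ (t : Finset H) (ε : ℝ), 0 < ε → ∃ c ∈ M, ∀ h ∈ t, ‖c h - a h‖ < ε

/-- The selfadjoint elements of norm at most `r` of a ⋆-subalgebra. -/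
def selfAdjointBall (C : NonUnitalStarSubalgebra ℂ (H →L[ℂ] H)) (r : ℝ) : Set (H →L[ℂ] H) :=
  {c | c ∈ C ∧ IsSelfAdjoint c ∧ ‖c‖ ≤ r}

theorem InStrongClosure.add_ball {C : NonUnitalStarSubalgebra ℂ (H →L[ℂ] H)} {r s : ℝ}
    {a b : H →L[ℂ] H} (ha : InStrongClosure (selfAdjointBall C r) a)
    (hb : InStrongClosure (selfAdjointBall C s) b) :
    InStrongClosure (selfAdjointBall C (r + s)) (a + b) := by
  intro t ε hε
  obtain ⟨c, ⟨hc, hcs, hcr⟩, hca⟩ := ha t (ε / 2) (by positivity)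
  obtain ⟨d, ⟨hd, hds, hdr⟩, hdb⟩ := hb t (ε / 2) (by positivity)
  refine ⟨c + d, ⟨add_mem hc hd, hcs.add hds, (norm_add_le _ _).trans (by linarith)⟩,
    fun h hh => ?_⟩
  have : (c + d) h - (a + b) h = (c h - a h) + (d h - b h) := by
    simp only [add_apply]; abel
  rw [this]
  exact (norm_add_le _ _).trans_lt (by linarith [hca h hh, hdb h hh])

theorem InStrongClosure.sub_selfAdjoint {C : NonUnitalStarSubalgebra ℂ (H →L[ℂ] H)} {r : ℝ}
    {a b : H →L[ℂ] H} (ha : InStrongClosure {c | c ∈ C ∧ IsSelfAdjoint c} a)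
    (hb : InStrongClosure (selfAdjointBall C r) b) :
    InStrongClosure {c | c ∈ C ∧ IsSelfAdjoint c} (a - b) := by
  intro t ε hε
  obtain ⟨c, ⟨hc, hcs⟩, hca⟩ := ha t (ε / 2) (by positivity)
  obtain ⟨d, ⟨hd, hds, -⟩, hdb⟩ := hb t (ε / 2) (by positivity)
  refine ⟨c - d, ⟨sub_mem hc hd, hcs.sub hds⟩, fun h hh => ?_⟩
  have : (c - d) h - (a - b) h = (c h - a h) - (d h - b h) := by
    simp only [sub_apply]; abel
  rw [this]
  exact (norm_sub_le _ _).trans_lt (by linarith [hca h hh, hdb h hh])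

/-- The function `t ↦ t / (1 + s t ^ 2)`, applied to a selfadjoint operator. -/
def damp (s : ℝ) (a : H →L[ℂ] H) : H →L[ℂ] H := cfc (fun t : ℝ => t * (1 + s * t ^ 2)⁻¹) a

/-- The function `t ↦ 1 / (1 + s t ^ 2)`, applied to a selfadjoint operator. -/
def dampInv (s : ℝ) (a : H →L[ℂ] H) : H →L[ℂ] H := cfc (fun t : ℝ => (1 + s * t ^ 2)⁻¹) a

theorem continuous_dampInv_aux {s : ℝ} (hs : 0 < s) :
    Continuous fun t : ℝ => (1 + s * t ^ 2)⁻¹ := by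
  refine Continuous.inv₀ (by fun_prop) fun t => ?_
  positivity

theorem damp_eq {s : ℝ} (hs : 0 < s) {a : H →L[ℂ] H} (ha : IsSelfAdjoint a) :
    damp s a = a * dampInv s a := by
  have h := (continuous_dampInv_aux hs).continuousOn (s := spectrum ℝ a)
  unfold damp dampInv
  rw [cfc_mul (fun t : ℝ => t) _ a (by fun_prop) h, cfc_id' ℝ a]

theorem damp_eq_mul_right {s : ℝ} (hs : 0 < s) {a : H →L[ℂ] H} (ha : IsSelfAdjoint a) :
    damp s a = dampInv s a * a := by
  rw [damp_eq hs ha]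
  have := (cfc_commute_cfc (fun t : ℝ => t) (fun t : ℝ => (1 + s * t ^ 2)⁻¹) a).eq
  rwa [cfc_id' ℝ a] at this

theorem dampInv_add {s : ℝ} (hs : 0 < s) {a : H →L[ℂ] H} (ha : IsSelfAdjoint a) :
    dampInv s a + s • (a * (a * dampInv s a)) = 1 := by
  have h := (continuous_dampInv_aux hs).continuousOn (s := spectrum ℝ a)
  have h1 : ContinuousOn (fun t : ℝ => t * (1 + s * t ^ 2)⁻¹) (spectrum ℝ a) :=
    continuousOn_id.mul h
  have h2 : ContinuousOn (fun t : ℝ => t * (t * (1 + s * t ^ 2)⁻¹)) (spectrum ℝ a) :=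
    continuousOn_id.mul h1
  rw [← cfc_one ℝ a]
  have e : a * (a * dampInv s a) = cfc (fun t : ℝ => t * (t * (1 + s * t ^ 2)⁻¹)) a := by
    rw [cfc_mul (fun t : ℝ => t) _ a (by fun_prop) h1,
      cfc_mul (fun t : ℝ => t) _ a (by fun_prop) h, cfc_id' ℝ a]
    rfl
  rw [e, ← cfc_smul _ _ _ h2, dampInv, ← cfc_add a _ _ h (by exact h2.const_smul s)]
  refine cfc_congr fun t _ => ?_
  have : (1 + s * t ^ 2) ≠ 0 := by positivity
  simp only [smul_eq_mul, Pi.one_apply]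
  field_simp

theorem dampInv_add_right {s : ℝ} (hs : 0 < s) {a : H →L[ℂ] H} (ha : IsSelfAdjoint a) :
    dampInv s a + s • (dampInv s a * a * a) = 1 := by
  rw [← damp_eq_mul_right hs ha, damp_eq hs ha]
  have := dampInv_add hs ha
  rw [← damp_eq hs ha, damp_eq_mul_right hs ha, ← mul_assoc, ← damp_eq hs ha] at this
  rwa [damp_eq hs ha] at this

/-- A resolvent-type identity. To the right of c - a stand operators that do not involve c, to its
left operators bounded independently of c; so the functional calculus is strongly continuous without
a bound on c. -/
theorem damp_sub {s : ℝ} (hs : 0 < s) {a c : H →L[ℂ] H} (ha : IsSelfAdjoint a)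
    (hc : IsSelfAdjoint c) : damp s c - damp s a =
      dampInv s c * (c - a) * dampInv s a - s • (damp s c * (c - a) * (a * dampInv s a)) := by
  have h1 := dampInv_add hs ha
  have h2 := dampInv_add_right hs hc
  calc damp s c - damp s a
      = damp s c * (dampInv s a + s • (a * (a * dampInv s a)))
        - (dampInv s c + s • (dampInv s c * c * c)) * damp s a := by rw [h1, h2, mul_one, one_mul]
    _ = _ := by
      rw [damp_eq_mul_right hs hc, damp_eq hs ha]
      simp only [mul_add, add_mul, mul_sub, sub_mul, mul_smul_comm, smul_mul_assoc, smul_sub,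
        mul_assoc]
      abel

theorem norm_dampInv_le {s : ℝ} (hs : 0 < s) (a : H →L[ℂ] H) : ‖dampInv s a‖ ≤ 1 := by
  refine norm_cfc_le zero_le_one fun t _ => ?_
  have : 0 ≤ s * t ^ 2 := by positivity
  rw [Real.norm_of_nonneg (by positivity)]
  exact inv_le_one_of_one_le₀ (by linarith)

/-- For s = 1 / (4 m ^ 2) the function t / (1 + s t ^ 2) has its maximum m at t = 2 m. -/
theorem norm_damp_le {m : ℝ} (hm : 0 < m) (a : H →L[ℂ] H) : ‖damp (1 / (4 * m ^ 2)) a‖ ≤ m := by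
  refine norm_cfc_le hm.le fun t _ => ?_
  have hp : 0 < 1 + 1 / (4 * m ^ 2) * t ^ 2 := by positivity
  rw [norm_mul, Real.norm_of_nonneg (inv_nonneg.mpr hp.le), ← div_eq_mul_inv, div_le_iff₀ hp,
    Real.norm_eq_abs]
  have : m * (1 + 1 / (4 * m ^ 2) * t ^ 2) - |t| = (2 * m - |t|) ^ 2 / (4 * m) := by
    rw [← sq_abs t]; field_simp; ring
  have h2 : 0 ≤ (2 * m - |t|) ^ 2 / (4 * m) := by positivity
  linarith

theorem norm_sub_damp_le {m : ℝ} (hm : 0 < m) {a : H →L[ℂ] H} (ha : IsSelfAdjoint a)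
    (ham : ‖a‖ ≤ m) : ‖a - damp (1 / (4 * m ^ 2)) a‖ ≤ m / 4 := by
  have hs : 0 < 1 / (4 * m ^ 2) := by positivity
  have h := (continuous_dampInv_aux hs).continuousOn (s := spectrum ℝ a)
  have h1 : ContinuousOn (fun t : ℝ => t * (1 + 1 / (4 * m ^ 2) * t ^ 2)⁻¹) (spectrum ℝ a) :=
    continuousOn_id.mul h
  have e : a - damp (1 / (4 * m ^ 2)) a =
      cfc (fun t : ℝ => t - t * (1 + 1 / (4 * m ^ 2) * t ^ 2)⁻¹) a := by
    rw [cfc_sub (fun t : ℝ => t) _ a (by fun_prop) h1, cfc_id' ℝ a]; rfl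
  rw [e]
  refine norm_cfc_le (by positivity) fun t ht => ?_
  have htm : |t| ≤ m := by
    have := norm_apply_le_norm_cfc (fun t : ℝ => t) a ht
    rw [cfc_id' ℝ a] at this
    exact this.trans ham
  have hp : 0 < 1 + 1 / (4 * m ^ 2) * t ^ 2 := by positivity
  have : t - t * (1 + 1 / (4 * m ^ 2) * t ^ 2)⁻¹ =
      t * (t ^ 2 / (4 * m ^ 2)) * (1 + 1 / (4 * m ^ 2) * t ^ 2)⁻¹ := by
    field_simp; ring
  have hp1 : (1 + 1 / (4 * m ^ 2) * t ^ 2)⁻¹ ≤ 1 :=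
    inv_le_one_of_one_le₀ (by linarith [show 0 ≤ 1 / (4 * m ^ 2) * t ^ 2 by positivity])
  have ht2 : t ^ 2 / (4 * m ^ 2) ≤ 1 / 4 := by
    rw [div_le_div_iff₀ (by positivity) (by norm_num)]
    nlinarith [sq_abs t, abs_nonneg t]
  rw [this, norm_mul, norm_mul, Real.norm_of_nonneg (show 0 ≤ t ^ 2 / (4 * m ^ 2) by positivity),
    Real.norm_of_nonneg (inv_nonneg.mpr hp.le), Real.norm_eq_abs]
  calc |t| * (t ^ 2 / (4 * m ^ 2)) * (1 + 1 / (4 * m ^ 2) * t ^ 2)⁻¹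
      ≤ m * (1 / 4) * 1 := by gcongr
    _ = m / 4 := by ring

theorem isSelfAdjoint_damp (s : ℝ) (a : H →L[ℂ] H) : IsSelfAdjoint (damp s a) :=
  cfc_predicate _ a

/-- The function vanishes at 0, so the non-unital functional calculus applies and C need not contain
1. -/
theorem damp_mem_topologicalClosure (C : NonUnitalStarSubalgebra ℂ (H →L[ℂ] H)) {s : ℝ}
    {c : H →L[ℂ] H} (hs : 0 < s) (hc : c ∈ C) : damp s c ∈ C.topologicalClosure := by
  have h := (continuous_dampInv_aux hs).continuousOn (s := spectrum ℝ c)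
  have hcl : IsClosed (C.topologicalClosure : Set (H →L[ℂ] H)) :=
    NonUnitalStarSubalgebra.isClosed_topologicalClosure C
  rw [damp, ← cfcₙ_eq_cfc (by
    exact (continuous_id.mul (continuous_dampInv_aux hs)).continuousOn) (by simp)]
  exact cfcₙ_mem (𝕜' := ℂ) (s := C.topologicalClosure) _
    (NonUnitalStarSubalgebra.le_topologicalClosure C hc)

/-- Damping approximants of a bounds them by m. The radius is 2 m because `damp s c` lies only in
the norm closure of C and is replaced by an element of C at distance less than m. -/
theorem inStrongClosure_damp {C : NonUnitalStarSubalgebra ℂ (H →L[ℂ] H)} {a : H →L[ℂ] H} {m : ℝ}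
    (hm : 0 < m) (hsa : IsSelfAdjoint a)
    (ha : InStrongClosure {c | c ∈ C ∧ IsSelfAdjoint c} a) :
    InStrongClosure (selfAdjointBall C (2 * m)) (damp (1 / (4 * m ^ 2)) a) := by
  classical
  set s := 1 / (4 * m ^ 2) with hs_def
  have hs : 0 < s := by positivity
  intro t ε hε
  obtain ⟨c, ⟨hcC, hcs⟩, hc⟩ := ha (t.image (dampInv s a) ∪ t.image (a * dampInv s a))
    (ε / 2 / (1 + s * m)) (by positivity)
  have hN : 0 ≤ ∑ h ∈ t, ‖h‖ := Finset.sum_nonneg fun _ _ => norm_nonneg _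
  obtain ⟨d, hdC, hd⟩ := Metric.mem_closure_iff.mp
    (show damp s c ∈ closure (C : Set (H →L[ℂ] H)) from damp_mem_topologicalClosure C hs hcC)
    (min m (ε / 2 / (1 + ∑ h ∈ t, ‖h‖))) (by positivity)
  have hdsa := isSelfAdjoint_damp s c
  set e : H →L[ℂ] H := (1 / 2 : ℂ) • (d + star d) with he
  have hed : ‖e - damp s c‖ < min m (ε / 2 / (1 + ∑ h ∈ t, ‖h‖)) := by
    have e1 : e - damp s c = (1 / 2 : ℂ) • ((d - damp s c) + star (d - damp s c)) := by
      rw [star_sub, hdsa.star_eq, he]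
      module
    have e2 : ‖d - damp s c‖ < min m (ε / 2 / (1 + ∑ h ∈ t, ‖h‖)) := by
      rwa [← dist_eq_norm, dist_comm]
    rw [e1, norm_smul]
    have e3 := norm_add_le (d - damp s c) (star (d - damp s c))
    rw [norm_star] at e3
    have e4 : ‖(1 / 2 : ℂ)‖ = 1 / 2 := by norm_num
    rw [e4]
    linarith
  refine ⟨e, ⟨SMulMemClass.smul_mem _ (add_mem hdC (star_mem hdC)), ?_, ?_⟩, fun h hh => ?_⟩
  · rw [he, isSelfAdjoint_iff, star_smul, star_add, star_star, add_comm]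
    simp
  · have := norm_add_le (e - damp s c) (damp s c)
    rw [sub_add_cancel] at this
    linarith [hed.trans_le (min_le_left _ _), norm_damp_le hm c]
  · have h1 := hc (dampInv s a h) (Finset.mem_union_left _ (Finset.mem_image_of_mem _ hh))
    have h2 := hc ((a * dampInv s a) h) (Finset.mem_union_right _ (Finset.mem_image_of_mem _ hh))
    have h3 : ‖(damp s c - damp s a) h‖ ≤
        ‖c (dampInv s a h) - a (dampInv s a h)‖ +
          s * m * ‖c ((a * dampInv s a) h) - a ((a * dampInv s a) h)‖ := by
      rw [damp_sub hs hsa hcs]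
      refine (norm_sub_le _ _).trans (add_le_add ?_ ?_)
      · refine ((dampInv s c).le_opNorm _).trans ?_
        exact (mul_le_mul_of_nonneg_right (norm_dampInv_le hs c) (norm_nonneg _)).trans_eq
          (one_mul _)
      · change ‖s • damp s c ((c - a) ((a * dampInv s a) h))‖ ≤ _
        rw [norm_smul, Real.norm_of_nonneg hs.le, mul_assoc]
        refine mul_le_mul_of_nonneg_left (((damp s c).le_opNorm _).trans ?_) hs.le
        exact mul_le_mul_of_nonneg_right (norm_damp_le hm c) (norm_nonneg _)
    have h4 : ‖(e - damp s c) h‖ ≤ ε / 2 := by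
      refine ((e - damp s c).le_opNorm h).trans ?_
      have h5 : ‖h‖ ≤ 1 + ∑ h ∈ t, ‖h‖ := by
        linarith [Finset.single_le_sum (f := fun h : H => ‖h‖) (fun i _ => norm_nonneg i) hh]
      calc ‖e - damp s c‖ * ‖h‖ ≤ (ε / 2 / (1 + ∑ h ∈ t, ‖h‖)) * (1 + ∑ h ∈ t, ‖h‖) := by
            gcongr
            exact (hed.trans_le (min_le_right _ _)).le
        _ = ε / 2 := by field_simp
    have h6 : ‖c (dampInv s a h) - a (dampInv s a h)‖ +
          s * m * ‖c ((a * dampInv s a) h) - a ((a * dampInv s a) h)‖ < ε / 2 := by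
      have : s * m * ‖c ((a * dampInv s a) h) - a ((a * dampInv s a) h)‖ ≤
          s * m * (ε / 2 / (1 + s * m)) := by gcongr
      have h7 : ε / 2 / (1 + s * m) + s * m * (ε / 2 / (1 + s * m)) = ε / 2 := by
        field_simp
      linarith
    have : e h - damp s a h = (e - damp s c) h + (damp s c - damp s a) h := by
      simp
    rw [this]
    exact (norm_add_le _ _).trans_lt (by linarith)

/-- Successive approximation: subtracting its damped version from a remainder of norm at most m
leaves one of norm at most m / 4, again in the strong closure. The bounds on the approximants of the
subtracted pieces form a geometric series. -/
theorem exists_inStrongClosure_selfAdjointBall {C : NonUnitalStarSubalgebra ℂ (H →L[ℂ] H)}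
    {a : H →L[ℂ] H} (hsa : IsSelfAdjoint a)
    (ha : InStrongClosure {c | c ∈ C ∧ IsSelfAdjoint c} a) :
    ∃ r, InStrongClosure (selfAdjointBall C r) a := by
  set m := ‖a‖ + 1 with hm_def
  have hm : 0 < m := by positivity
  -- Step k adds 2 m / 4 ^ k to the radius, less than the increment 3 m / 4 ^ k of 4 m (1 - 1 / 4 ^
  -- k).
  have key : ∀ k : ℕ, ∃ b : H →L[ℂ] H, IsSelfAdjoint b ∧
      InStrongClosure {c | c ∈ C ∧ IsSelfAdjoint c} b ∧ ‖b‖ ≤ m / 4 ^ k ∧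
      InStrongClosure (selfAdjointBall C (4 * m * (1 - 1 / 4 ^ k))) (a - b) := by
    intro k
    induction k with
    | zero =>
      refine ⟨a, hsa, ha, by simp [hm_def], fun t ε hε => ⟨0, ⟨zero_mem _, ?_, by simp⟩, ?_⟩⟩
      · exact IsSelfAdjoint.zero _
      · simp [hε]
    | succ k ih =>
      obtain ⟨b, hb, hbC, hbm, hab⟩ := ih
      have hmk : 0 < m / 4 ^ k := by positivity
      have h := inStrongClosure_damp hmk hb hbC
      refine ⟨b - damp (1 / (4 * (m / 4 ^ k) ^ 2)) b, hb.sub (isSelfAdjoint_damp _ _),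
        hbC.sub_selfAdjoint h, (norm_sub_damp_le hmk hb hbm).trans_eq ?_, ?_⟩
      · rw [pow_succ]; field_simp
      · have h2 := hab.add_ball h
        have e : a - b + damp (1 / (4 * (m / 4 ^ k) ^ 2)) b =
            a - (b - damp (1 / (4 * (m / 4 ^ k) ^ 2)) b) := by abel
        rw [e] at h2
        intro t ε hε
        obtain ⟨c, ⟨h3, h4, h5⟩, h6⟩ := h2 t ε hε
        refine ⟨c, ⟨h3, h4, h5.trans ?_⟩, h6⟩
        have : (0 : ℝ) < 4 ^ k := by positivity
        rw [pow_succ, ← sub_nonneg]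
        have : 4 * m * (1 - 1 / (4 ^ k * 4)) - (4 * m * (1 - 1 / 4 ^ k) + 2 * (m / 4 ^ k)) =
          m / 4 ^ k := by field_simp; ring
        rw [this]; positivity
  refine ⟨4 * m, fun t ε hε => ?_⟩
  have hN : 0 ≤ ∑ h ∈ t, ‖h‖ := Finset.sum_nonneg fun _ _ => norm_nonneg _
  obtain ⟨k, hk⟩ : ∃ k : ℕ, (1 / 4 : ℝ) ^ k < ε / 2 / (m * (1 + ∑ h ∈ t, ‖h‖)) :=
    exists_pow_lt_of_lt_one (by positivity) (by norm_num)
  obtain ⟨b, -, -, hbm, hab⟩ := key k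
  obtain ⟨c, ⟨h3, h4, h5⟩, h6⟩ := hab t (ε / 2) (by positivity)
  refine ⟨c, ⟨h3, h4, h5.trans ?_⟩, fun h hh => ?_⟩
  · have : 0 ≤ m * (1 / 4 ^ k) := by positivity
    nlinarith
  · have e : c h - a h = (c h - (a - b) h) - b h := by simp only [sub_apply]; abel
    have h7 : ‖h‖ ≤ 1 + ∑ h ∈ t, ‖h‖ := by
      linarith [Finset.single_le_sum (f := fun h : H => ‖h‖) (fun i _ => norm_nonneg i) hh]
    have h8 : ‖b h‖ ≤ ε / 2 := by
      refine (b.le_opNorm h).trans ?_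
      calc ‖b‖ * ‖h‖ ≤ (m / 4 ^ k) * (1 + ∑ h ∈ t, ‖h‖) := by gcongr
        _ = (1 / 4) ^ k * (m * (1 + ∑ h ∈ t, ‖h‖)) := by rw [one_div, inv_pow]; ring
        _ ≤ ε / 2 / (m * (1 + ∑ h ∈ t, ‖h‖)) * (m * (1 + ∑ h ∈ t, ‖h‖)) := by gcongr
        _ = ε / 2 := by field_simp
    rw [e]
    exact (norm_sub_le _ _).trans_lt (by linarith [h6 h hh])

/-- The weak operator topology on `B(H)`, as a convergence notion: `F` is eventually norm-bounded
and converges to `a` along all matrix coefficients. -/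
structure BoundedWeakTendsto {ι : Type*} (f : ι → H →L[ℂ] H) (F : Filter ι) (a : H →L[ℂ] H) :
    Prop where
  bounded : ∃ r : ℝ, ∀ᶠ i in F, ‖f i‖ ≤ r
  tendsto : ∀ h k : H, Tendsto (fun i => ⟪k, f i h⟫_ℂ) F (𝓝 ⟪k, a h⟫_ℂ)

theorem exists_boundedWeakTendsto_of_inStrongClosure {C : NonUnitalStarSubalgebra ℂ (H →L[ℂ] H)}
    {a : H →L[ℂ] H} {r : ℝ} (ha : InStrongClosure (selfAdjointBall C r) a) :
    ∃ F : Filter (H →L[ℂ] H), F.NeBot ∧ (∀ᶠ c in F, c ∈ C) ∧ BoundedWeakTendsto id F a := by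
  unfold InStrongClosure at ha
  choose c hc hca using ha
  classical
  let f : Finset H × ℕ → (H →L[ℂ] H) := fun p => c p.1 (1 / (p.2 + 1)) (by positivity)
  refine ⟨map f atTop, inferInstance, ?_, ⟨r, ?_⟩, fun h k => ?_⟩
  · exact eventually_map.2 (Eventually.of_forall fun p =>
      (hc p.1 (1 / (p.2 + 1)) (by positivity)).1)
  · exact eventually_map.2 (Eventually.of_forall fun p =>
      (hc p.1 (1 / (p.2 + 1)) (by positivity)).2.2)
  · rw [tendsto_map'_iff]
    have h1 : Tendsto (fun p : Finset H × ℕ => f p h) atTop (𝓝 (a h)) := by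
      rw [tendsto_iff_norm_sub_tendsto_zero]
      have h2 : Tendsto (fun p : Finset H × ℕ => 1 / ((p.2 : ℝ) + 1)) atTop (𝓝 0) := by
        rw [← prod_atTop_atTop_eq]
        exact tendsto_one_div_add_atTop_nhds_zero_nat.comp tendsto_snd
      refine squeeze_zero' (Eventually.of_forall fun _ => norm_nonneg _) ?_ h2
      filter_upwards [eventually_ge_atTop (({h}, 0) : Finset H × ℕ)] with p hp
      exact (hca p.1 (1 / (p.2 + 1)) (by positivity) h
        (hp.1 (Finset.mem_singleton_self h))).le
    exact (continuous_const.inner continuous_id).continuousAt.tendsto.comp h1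

end Kaplansky

/-! ### Bounded weak operator convergence and weak compactness of balls. -/

section WeakConvergence

variable {H : Type u} [NormedAddCommGroup H] [InnerProductSpace ℂ H] [CompleteSpace H]

namespace BoundedWeakTendsto

variable {ι : Type*} {f g : ι → H →L[ℂ] H} {F : Filter ι} {a b : H →L[ℂ] H}

theorem mono {G : Filter ι} (h : BoundedWeakTendsto f F a) (hG : G ≤ F) :
    BoundedWeakTendsto f G a :=
  ⟨h.bounded.imp fun _ hr => hr.filter_mono hG, fun x y => (h.tendsto x y).mono_left hG⟩

theorem add (hf : BoundedWeakTendsto f F a) (hg : BoundedWeakTendsto g F b) :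
    BoundedWeakTendsto (fun i => f i + g i) F (a + b) := by
  obtain ⟨r, hr⟩ := hf.bounded
  obtain ⟨s, hs⟩ := hg.bounded
  refine ⟨⟨r + s, ?_⟩, fun h k => ?_⟩
  · filter_upwards [hr, hs] with i h1 h2
    exact (norm_add_le _ _).trans (add_le_add h1 h2)
  · simpa [inner_add_right] using (hf.tendsto h k).add (hg.tendsto h k)

theorem const_smul (c : ℂ) (hf : BoundedWeakTendsto f F a) :
    BoundedWeakTendsto (fun i => c • f i) F (c • a) := by
  obtain ⟨r, hr⟩ := hf.bounded
  refine ⟨⟨‖c‖ * r, ?_⟩, fun h k => ?_⟩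
  · filter_upwards [hr] with i h1
    rw [norm_smul]
    gcongr
  · simpa [inner_smul_right] using (hf.tendsto h k).const_mul c

theorem mul_mul (c d : H →L[ℂ] H) (hf : BoundedWeakTendsto f F a) :
    BoundedWeakTendsto (fun i => c * f i * d) F (c * a * d) := by
  obtain ⟨r, hr⟩ := hf.bounded
  refine ⟨⟨‖c‖ * r * ‖d‖, ?_⟩, fun h k => ?_⟩
  · filter_upwards [hr] with i h1
    refine (norm_mul_le _ _).trans (mul_le_mul_of_nonneg_right
      ((norm_mul_le _ _).trans ?_) (norm_nonneg _))
    gcongr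
  · simpa [ContinuousLinearMap.adjoint_inner_left] using
      hf.tendsto (d h) (ContinuousLinearMap.adjoint c k)

theorem unique [F.NeBot] (ha : BoundedWeakTendsto f F a) (hb : BoundedWeakTendsto f F b) :
    a = b :=
  ContinuousLinearMap.ext fun h => ext_inner_left ℂ fun k =>
    tendsto_nhds_unique (ha.tendsto h k) (hb.tendsto h k)

theorem comp {κ : Type*} {G : Filter κ} {m : κ → ι} (h : BoundedWeakTendsto f F a)
    (hm : Tendsto m G F) : BoundedWeakTendsto (fun i => f (m i)) G a :=
  ⟨h.bounded.imp fun _ hr => hm.eventually hr, fun x y => (h.tendsto x y).comp hm⟩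

theorem tendsto_wot (h : BoundedWeakTendsto f F a) :
    Tendsto (fun i => ContinuousLinearMapWOT.ofCLM (f i)) F
      (𝓝 (ContinuousLinearMapWOT.ofCLM a)) :=
  ContinuousLinearMapWOT.tendsto_iff_forall_inner_apply_tendsto.mpr h.tendsto

/-- A closed subspace is its own double orthogonal complement, and orthogonality passes to weak
limits. -/
theorem apply_mem_of_isClosed {K : Submodule ℂ H} (hK : IsClosed (K : Set H)) [F.NeBot] {h : H}
    (hf : BoundedWeakTendsto f F a) (hmem : ∀ᶠ i in F, f i h ∈ K) : a h ∈ K := by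
  have : CompleteSpace K := hK.completeSpace_coe
  rw [← K.orthogonal_orthogonal, Submodule.mem_orthogonal]
  intro k hk
  refine tendsto_nhds_unique (hf.tendsto h k) (tendsto_const_nhds.congr' ?_)
  filter_upwards [hmem] with i hi
  exact ((Submodule.mem_orthogonal' K k).mp hk _ hi).symm

end BoundedWeakTendsto

/-- The weak limit of a norm-bounded ultrafilter of operators. -/
theorem exists_boundedWeakTendsto_ultrafilter {ι : Type*} (f : ι → H →L[ℂ] H) (U : Ultrafilter ι)
    (hf : ∃ r : ℝ, ∀ᶠ i in (U : Filter ι), ‖f i‖ ≤ r) : ∃ a, BoundedWeakTendsto f U a := by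
  obtain ⟨r, hr⟩ := hf
  have hr0 : 0 ≤ r := by
    obtain ⟨i, hi⟩ := hr.exists
    exact (norm_nonneg _).trans hi
  have hbd : ∀ h k : H, ∀ᶠ i in (U : Filter ι), ‖⟪f i h, k⟫_ℂ‖ ≤ r * ‖h‖ * ‖k‖ := by
    intro h k
    filter_upwards [hr] with i hi
    refine (norm_inner_le_norm _ _).trans ?_
    gcongr
    exact (f i).le_of_opNorm_le hi h
  have hlim : ∀ h k : H, ∃ z : ℂ, ‖z‖ ≤ r * ‖h‖ * ‖k‖ ∧
      Tendsto (fun i => ⟪f i h, k⟫_ℂ) U (𝓝 z) := by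
    intro h k
    obtain ⟨z, hz, hz'⟩ := (isCompact_closedBall (0 : ℂ) (r * ‖h‖ * ‖k‖)).ultrafilter_le_nhds
      (U.map fun i => ⟪f i h, k⟫_ℂ) (by
        rw [le_principal_iff]
        refine (hbd h k).mono fun i hi => ?_
        simpa using hi)
    exact ⟨z, by simpa using hz, hz'⟩
  choose b hb hbt using hlim
  -- The limits of the matrix coefficients form a bounded sesquilinear form; the Riesz theorem turns
  -- it into an operator.
  let B₀ : H →ₗ⋆[ℂ] H →ₗ[ℂ] ℂ := LinearMap.mk₂'ₛₗ (starRingEnd ℂ) (RingHom.id ℂ) b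
    (fun h h' k => tendsto_nhds_unique (hbt _ _) (by
      simpa [inner_add_left] using (hbt h k).add (hbt h' k)))
    (fun c h k => tendsto_nhds_unique (hbt _ _) (by
      simpa [inner_smul_left, mul_comm] using (hbt h k).const_mul (starRingEnd ℂ c)))
    (fun h k k' => tendsto_nhds_unique (hbt _ _) (by
      simpa [inner_add_right] using (hbt h k).add (hbt h k')))
    (fun c h k => tendsto_nhds_unique (hbt _ _) (by
      simpa [inner_smul_right] using (hbt h k).const_mul c))
  let B : H →L⋆[ℂ] H →L[ℂ] ℂ := LinearMap.mkContinuous₂ B₀ r hb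
  refine ⟨InnerProductSpace.continuousLinearMapOfBilin B, ⟨r, hr⟩, fun h k => ?_⟩
  have h1 : ⟪InnerProductSpace.continuousLinearMapOfBilin B h, k⟫_ℂ = b h k :=
    InnerProductSpace.continuousLinearMapOfBilin_apply B h k
  have h2 := (Complex.continuous_conj.tendsto _).comp (hbt h k)
  rw [← h1] at h2
  simpa only [Function.comp_def, inner_conj_symm] using h2

end WeakConvergence

/-! ### Weak and strong closures of convex sets; Kaplansky density. -/

section Density

variable {H : Type u} [NormedAddCommGroup H] [InnerProductSpace ℂ H] [CompleteSpace H]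

/-- A convex set of operators has the same closure for the weak and the strong operator
topologies. -/
theorem inStrongClosure_of_mem_closure_wot {M : Set (H →L[ℂ] H)} (hM : Convex ℝ M)
    {a : H →L[ℂ] H}
    (ha : ContinuousLinearMapWOT.ofCLM a ∈ closure (ContinuousLinearMapWOT.ofCLM '' M)) :
    InStrongClosure M a := by
  classical
  intro t ε hε
  let ev : (H →L[ℂ] H) →ₗ[ℝ] (t → H) :=
    { toFun := fun b i => b i
      map_add' := fun _ _ => rfl
      map_smul' := fun _ _ => rfl }
  -- Hahn–Banach in the finite power of H: a separating functional is a finite sum of functionals b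
  -- ↦ f_i (b h_i), which are continuous for the weak operator topology.
  have hmem : ev a ∈ closure (ev '' M) := by
    by_contra hcon
    obtain ⟨f, u, hfu, huf⟩ := RCLike.geometric_hahn_banach_closed_point (𝕜 := ℂ)
      ((hM.linear_image ev).closure) isClosed_closure hcon
    have hf : ∀ b : H →L[ℂ] H, f (ev b) =
        ∑ i : t, (f.comp (ContinuousLinearMap.single ℂ (fun _ : t => H) i)) (b i) := by
      intro b
      conv_lhs => rw [← Finset.univ_sum_single (ev b), map_sum]
      rfl
    have hcont : Continuous fun b : H →WOT[ℂ] H => (f (ev b.toCLM)).re := by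
      simp only [hf]
      refine Complex.continuous_re.comp (continuous_finsetSum _ fun i _ => ?_)
      exact ContinuousLinearMapWOT.continuous_dual_apply (i : H) _
    have hcl : IsClosed {b : H →WOT[ℂ] H | (f (ev b.toCLM)).re ≤ u} :=
      isClosed_le hcont continuous_const
    have : (f (ev a)).re ≤ u := by
      refine closure_minimal ?_ hcl ha
      rintro _ ⟨b, hb, rfl⟩
      exact (hfu _ (subset_closure ⟨b, hb, rfl⟩)).le
    exact absurd huf (not_lt.mpr this)
  obtain ⟨_, ⟨c, hc, rfl⟩, hd⟩ := Metric.mem_closure_iff.mp hmem ε hε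
  refine ⟨c, hc, fun h hh => ?_⟩
  have h1 := dist_le_pi_dist (ev a) (ev c) ⟨h, hh⟩
  rw [dist_comm, dist_eq_norm] at h1
  exact h1.trans_lt hd

/-- **Kaplansky density**, up to a constant: an element of the weak operator closure of a
⋆-subalgebra is the limit of a norm-bounded filter of elements of the subalgebra. -/
theorem exists_boundedWeakTendsto_of_mem_closure {C : NonUnitalStarSubalgebra ℂ (H →L[ℂ] H)}
    {a : H →L[ℂ] H}
    (ha : ContinuousLinearMapWOT.ofCLM a ∈
      closure (ContinuousLinearMapWOT.ofCLM '' (C : Set (H →L[ℂ] H)))) :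
    ∃ F : Filter (H →L[ℂ] H), F.NeBot ∧ (∀ᶠ c in F, c ∈ C) ∧ BoundedWeakTendsto id F a := by
  have hconv : Convex ℝ {c : H →L[ℂ] H | c ∈ C ∧ IsSelfAdjoint c} := by
    rintro c ⟨hc, hcs⟩ d ⟨hd, hds⟩ α β - - -
    refine ⟨add_mem ?_ ?_, (IsSelfAdjoint.smul (by simp [isSelfAdjoint_iff]) hcs).add
      (IsSelfAdjoint.smul (by simp [isSelfAdjoint_iff]) hds)⟩
    · rw [← Complex.coe_smul]; exact SMulMemClass.smul_mem _ hc
    · rw [← Complex.coe_smul]; exact SMulMemClass.smul_mem _ hd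
  -- z = 1/2 and z = -i/2 give the real and imaginary parts of a. The adjoint is weakly continuous,
  -- so these parts are weak limits of selfadjoint elements of C.
  have key : ∀ z : ℂ, IsSelfAdjoint (z • a + star (z • a)) →
      ∃ F : Filter (H →L[ℂ] H), F.NeBot ∧ (∀ᶠ c in F, c ∈ C) ∧
        BoundedWeakTendsto id F (z • a + star (z • a)) := by
    intro z hz
    have h1 : ContinuousLinearMapWOT.ofCLM (z • a + star (z • a)) ∈
        closure (ContinuousLinearMapWOT.ofCLM '' {c : H →L[ℂ] H | c ∈ C ∧ IsSelfAdjoint c}) := by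
      have hc : Continuous fun b : H →WOT[ℂ] H => z • b + star (z • b) :=
        (continuous_const_smul z).add (continuous_const_smul z).star
      refine map_mem_closure (f := fun b : H →WOT[ℂ] H => z • b + star (z • b)) hc ha ?_
      rintro _ ⟨c, hc, rfl⟩
      have hzc : z • c ∈ C := SMulMemClass.smul_mem _ hc
      exact ⟨z • c + star (z • c), ⟨add_mem hzc (star_mem hzc), IsSelfAdjoint.add_star_self _⟩, rfl⟩
    obtain ⟨r, hr⟩ := exists_inStrongClosure_selfAdjointBall hz
      (inStrongClosure_of_mem_closure_wot hconv h1)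
    exact exists_boundedWeakTendsto_of_inStrongClosure hr
  obtain ⟨F, hF, hFC, hFa⟩ := key (1 / 2) (IsSelfAdjoint.add_star_self _)
  obtain ⟨G, hG, hGC, hGa⟩ := key (-Complex.I / 2) (IsSelfAdjoint.add_star_self _)
  refine ⟨map (fun p : (H →L[ℂ] H) × (H →L[ℂ] H) => p.1 + Complex.I • p.2) (F ×ˢ G),
    inferInstance, ?_, ?_⟩
  · rw [eventually_map]
    filter_upwards [hFC.prod_inl G, hGC.prod_inr F] with p h1 h2
    exact add_mem h1 (SMulMemClass.smul_mem _ h2)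
  · have h := (hFa.comp tendsto_fst).add ((hGa.comp (tendsto_snd (f := F))).const_smul Complex.I)
    have e : (1 / 2 : ℂ) • a + star ((1 / 2 : ℂ) • a) +
        Complex.I • ((-Complex.I / 2) • a + star ((-Complex.I / 2) • a)) = a := by
      simp only [star_smul, smul_add, smul_smul]
      rw [show star (1 / 2 : ℂ) = 1 / 2 by simp, show star (-Complex.I / 2) = Complex.I / 2 by simp,
        show Complex.I * (-Complex.I / 2) = 1 / 2 by
          linear_combination (-1 / 2 : ℂ) * Complex.I_sq,
        show Complex.I * (Complex.I / 2) = -(1 / 2) by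
          linear_combination (1 / 2 : ℂ) * Complex.I_sq]
      module
    rw [e] at h
    exact ⟨h.bounded, h.tendsto⟩

end Density

/-! ### Bounded limits, normality and closures inside a von Neumann algebra. -/

section VonNeumann

variable {H : Type u} [NormedAddCommGroup H] [InnerProductSpace ℂ H] [CompleteSpace H]
  {S : VonNeumannAlgebra H}

theorem isClosed_vonNeumannAlgebra (S : VonNeumannAlgebra H) :
    IsClosed (S.toStarSubalgebra : Set (H →L[ℂ] H)) := by
  have : (S.toStarSubalgebra : Set (H →L[ℂ] H)) =
      Set.centralizer (Set.centralizer (S : Set (H →L[ℂ] H))) := by simp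
  rw [this]
  exact Set.isClosed_centralizer _

/-- A von Neumann algebra is a C⋆-algebra. -/
abbrev cstarAlgebraVonNeumannAlgebra (S : VonNeumannAlgebra H) :
    CStarAlgebra S.toStarSubalgebra :=
  StarSubalgebra.cstarAlgebra S.toStarSubalgebra (h_closed := isClosed_vonNeumannAlgebra S)

/-- Norm-bounded convergence in the weak operator topology of a von Neumann algebra. -/
abbrev WTendsto (F : Filter S.toStarSubalgebra) (a : S.toStarSubalgebra) : Prop :=
  BoundedWeakTendsto (fun b : S.toStarSubalgebra => (b : H →L[ℂ] H)) F a

theorem exists_wTendsto_ultrafilter (U : Ultrafilter S.toStarSubalgebra)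
    (hU : ∃ r : ℝ, ∀ᶠ b in (U : Filter S.toStarSubalgebra), ‖b‖ ≤ r) :
    ∃ a : S.toStarSubalgebra, WTendsto (U : Filter S.toStarSubalgebra) a := by
  obtain ⟨a, ha⟩ := exists_boundedWeakTendsto_ultrafilter
    (fun b : S.toStarSubalgebra => (b : H →L[ℂ] H)) U hU
  -- Commuting with a fixed operator passes to weak limits, so the limit lies in the bicommutant.
  have hmem : a ∈ S.toStarSubalgebra := by
    have : a ∈ Set.centralizer (Set.centralizer (S : Set (H →L[ℂ] H))) := by
      intro c hc
      have h1 := ha.mul_mul c 1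
      have h2 := ha.mul_mul 1 c
      simp only [mul_one, one_mul] at h1 h2
      have e : (fun b : S.toStarSubalgebra => c * (b : H →L[ℂ] H)) =
          fun b : S.toStarSubalgebra => (b : H →L[ℂ] H) * c := by
        funext b
        exact (hc b b.2).symm
      rw [e] at h1
      exact h1.unique h2
    rwa [VonNeumannAlgebra.centralizer_centralizer] at this
  exact ⟨⟨a, hmem⟩, ha⟩

theorem IsNormal.tendsto {Y : Type v} [TopologicalSpace Y] {f : S.toStarSubalgebra → Y}
    (hf : IsNormal S f) {F : Filter S.toStarSubalgebra} {a : S.toStarSubalgebra}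
    (h : WTendsto F a) : Tendsto f F (𝓝 (f a)) := by
  obtain ⟨r, hr⟩ := h.bounded
  -- The ball has to contain the limit as well as the filter.
  have h1 := hf (max r ‖a‖) a (show ‖a‖ ≤ _ from le_max_right _ _)
  refine Tendsto.mono_left h1 ?_
  refine le_inf ?_ ?_
  · have e : @nhds _ (wot S) a = comap (toWOT S) (𝓝 (toWOT S a)) := nhds_induced _ _
    rw [e, ← tendsto_iff_comap]
    exact h.tendsto_wot
  · rw [le_principal_iff]
    filter_upwards [hr] with b hb
    exact le_trans hb (le_max_left _ _)

theorem isNormal_of_tendsto {Y : Type v} [TopologicalSpace Y] {f : S.toStarSubalgebra → Y}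
    (hf : ∀ (U : Ultrafilter S.toStarSubalgebra) (a : S.toStarSubalgebra),
      WTendsto (U : Filter S.toStarSubalgebra) a → Tendsto f U (𝓝 (f a))) : IsNormal S f := by
  intro r a ha
  refine tendsto_iff_ultrafilter _ _ _ |>.mpr fun U hU => hf U _ ⟨⟨r, ?_⟩, ?_⟩
  · have := le_principal_iff.mp (hU.trans inf_le_right)
    filter_upwards [this] with b hb using hb
  · have h1 : (U : Filter S.toStarSubalgebra) ≤ comap (toWOT S) (𝓝 (toWOT S a)) := by
      have e : @nhds _ (wot S) a = comap (toWOT S) (𝓝 (toWOT S a)) := nhds_induced _ _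
      rw [← e]
      exact hU.trans inf_le_left
    exact ContinuousLinearMapWOT.tendsto_iff_forall_inner_apply_tendsto.mp (tendsto_iff_comap.mpr h1)

theorem mem_wotClosure_iff {C : NonUnitalSubalgebra ℂ S.toStarSubalgebra}
    {a : S.toStarSubalgebra} : a ∈ wotClosure C ↔ toWOT S a ∈ closure (toWOT S '' C) :=
  Iff.rfl

theorem mem_wotClosure_of_wTendsto {C : NonUnitalSubalgebra ℂ S.toStarSubalgebra}
    {F : Filter S.toStarSubalgebra} [F.NeBot] {a : S.toStarSubalgebra} (h : WTendsto F a)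
    (hC : ∀ᶠ b in F, b ∈ wotClosure C) : a ∈ wotClosure C := by
  rw [mem_wotClosure_iff]
  exact isClosed_closure.mem_of_tendsto h.tendsto_wot hC

theorem le_wotClosure (C : NonUnitalSubalgebra ℂ S.toStarSubalgebra) : C ≤ wotClosure C :=
  fun _ ha => subset_closure (Set.mem_image_of_mem (toWOT S) ha)

/-- Kaplansky density in a von Neumann algebra. -/
theorem exists_wTendsto_of_mem_wotClosure {C : NonUnitalSubalgebra ℂ S.toStarSubalgebra}
    (hC : ∀ c ∈ C, star c ∈ C) {a : S.toStarSubalgebra} (ha : a ∈ wotClosure C) :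
    ∃ F : Filter S.toStarSubalgebra, F.NeBot ∧ (∀ᶠ c in F, c ∈ C) ∧ WTendsto F a := by
  let D : NonUnitalStarSubalgebra ℂ (H →L[ℂ] H) :=
    { C.map (S.toStarSubalgebra.subtype.toAlgHom) with
      star_mem' := by
        rintro _ ⟨c, hc, rfl⟩
        exact ⟨star c, hC c hc, rfl⟩ }
  have hD : (D : Set (H →L[ℂ] H)) = Subtype.val '' (C : Set S.toStarSubalgebra) := rfl
  obtain ⟨F, hF, hFD, hFa⟩ := exists_boundedWeakTendsto_of_mem_closure (C := D)
    (a := (a : H →L[ℂ] H)) (by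
      rw [hD, Set.image_image]
      exact ha)
  have hrange : ∀ᶠ c in F, c ∈ Set.range (Subtype.val : S.toStarSubalgebra → H →L[ℂ] H) := by
    filter_upwards [hFD] with c hc
    obtain ⟨d, -, rfl⟩ : c ∈ Subtype.val '' (C : Set S.toStarSubalgebra) := hc
    exact ⟨d, rfl⟩
  refine ⟨comap Subtype.val F, comap_neBot_iff_frequently.mpr hrange.frequently, ?_, ?_⟩
  · have := (tendsto_comap (f := (Subtype.val : S.toStarSubalgebra → H →L[ℂ] H))).eventually hFD
    filter_upwards [this] with c hc
    obtain ⟨d, hd, hdc⟩ : (c : H →L[ℂ] H) ∈ Subtype.val '' (C : Set S.toStarSubalgebra) := hc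
    rwa [← Subtype.ext hdc]
  · exact hFa.comp tendsto_comap

end VonNeumann

/-! ### The GNS construction. -/

section GNS

/-- The Gelfand–Naimark–Segal representation of a positive functional, with its cyclic vector. -/
theorem exists_gns {A : Type w} [CStarAlgebra A] (φ : A →ₗ[ℂ] ℂ)
    (hφ : ∀ a, 0 ≤ φ (star a * a)) :
    ∃ (K : Type w) (_ : NormedAddCommGroup K) (_ : InnerProductSpace ℂ K) (_ : CompleteSpace K)
      (π : A →⋆ₐ[ℂ] (K →L[ℂ] K)) (ξ : K),
      (∀ a, φ a = ⟪ξ, π a ξ⟫_ℂ) ∧ DenseRange fun a => π a ξ := by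
  let _ : PartialOrder A := CStarAlgebra.spectralOrder A
  let _ : StarOrderedRing A := CStarAlgebra.spectralOrderedRing A
  let f : A →ₚ[ℂ] ℂ := PositiveLinearMap.mk₀ φ (by
    intro a ha
    obtain ⟨b, rfl⟩ := CStarAlgebra.nonneg_iff_eq_star_mul_self.mp ha
    exact hφ b)
  have h1 : ∀ a : A, f.gnsStarAlgHom a ((f.toPreGNS 1 : f.PreGNS) : f.GNS) =
      ((f.toPreGNS a : f.PreGNS) : f.GNS) := by
    intro a
    change f.gnsNonUnitalStarAlgHom a ((f.toPreGNS 1 : f.PreGNS) : f.GNS) = _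
    rw [PositiveLinearMap.gnsNonUnitalStarAlgHom_apply_coe]
    simp
  refine ⟨f.GNS, inferInstance, inferInstance, inferInstance, f.gnsStarAlgHom,
    ((f.toPreGNS 1 : f.PreGNS) : f.GNS), fun a => ?_, ?_⟩
  · rw [h1, UniformSpace.Completion.inner_coe, PositiveLinearMap.preGNS_inner_def]
    simp [f]
    rfl
  · simp only [h1]
    exact UniformSpace.Completion.denseRange_coe.comp f.toPreGNS.surjective.denseRange
      (UniformSpace.Completion.continuous_coe _)

end GNS

/-! ### Operators determined by Gram matrices and dense sets. -/

section Contraction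

variable {K : Type u} [NormedAddCommGroup K] [InnerProductSpace ℂ K] [CompleteSpace K]

/-- Two families with the same Gram matrix, the first of them total, are related by a
contraction. -/
theorem exists_contraction_of_inner_eq {ι : Type*} {p q : ι → K}
    (h : ∀ i j, ⟪q i, q j⟫_ℂ = ⟪p i, p j⟫_ℂ)
    (hp : Dense (Submodule.span ℂ (Set.range p) : Set K)) :
    ∃ V : K →L[ℂ] K, ‖V‖ ≤ 1 ∧ ∀ i, V (p i) = q i := by
  let P := Finsupp.linearCombination ℂ p
  let Q := Finsupp.linearCombination ℂ q
  -- Equal norms make P f ↦ Q f well defined and isometric on the span of p, which is dense.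
  have hn : ∀ f, ‖Q f‖ = ‖P f‖ := by
    intro f
    have : ⟪Q f, Q f⟫_ℂ = ⟪P f, P f⟫_ℂ := by
      simp only [P, Q, Finsupp.linearCombination_apply, Finsupp.sum, sum_inner, inner_sum,
        inner_smul_left, inner_smul_right, h]
    rw [inner_self_eq_norm_sq_to_K, inner_self_eq_norm_sq_to_K] at this
    have h2 : ‖Q f‖ ^ 2 = ‖P f‖ ^ 2 := by exact_mod_cast this
    exact (sq_eq_sq₀ (norm_nonneg _) (norm_nonneg _)).mp h2
  have hP : DenseRange P := by
    rw [DenseRange, show Set.range P = (LinearMap.range P : Set K) from rfl,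
      Finsupp.range_linearCombination]
    exact hp
  refine ⟨Q.extendOfNorm P, ?_, fun i => ?_⟩
  · refine ContinuousLinearMap.opNorm_le_bound _ zero_le_one fun y => ?_
    exact LinearMap.norm_extendOfNorm_apply_le hP 1 (fun f => by rw [hn, one_mul]) y
  · have := LinearMap.extendOfNorm_eq (f := Q) (e := P) hP ⟨1, fun f => by rw [hn, one_mul]⟩
      (Finsupp.single i 1)
    simpa [P, Q] using this

theorem BoundedWeakTendsto.of_dense {ι : Type*} {f : ι → K →L[ℂ] K} {F : Filter ι}
    {a : K →L[ℂ] K} {D : Set K} (hD : Dense D) (hf : ∃ r : ℝ, ∀ᶠ i in F, ‖f i‖ ≤ r)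
    (h : ∀ y ∈ D, ∀ z ∈ D, Tendsto (fun i => ⟪z, f i y⟫_ℂ) F (𝓝 ⟪z, a y⟫_ℂ)) :
    BoundedWeakTendsto f F a := by
  refine ⟨hf, fun y z => ?_⟩
  obtain ⟨r, hr⟩ := hf
  set R := |r| + ‖a‖ with hR
  have hR0 : 0 ≤ R := by positivity
  rw [Metric.tendsto_nhds]
  intro ε hε
  obtain ⟨z', hz', hzz⟩ := Metric.mem_closure_iff.mp (hD z) (ε / 3 / (1 + R * ‖y‖))
    (by positivity)
  obtain ⟨y', hy', hyy⟩ := Metric.mem_closure_iff.mp (hD y) (ε / 3 / (1 + ‖z'‖ * R))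
    (by positivity)
  filter_upwards [hr, Metric.tendsto_nhds.mp (h y' hy' z' hz') (ε / 3) (by positivity)] with i h1 h2
  rw [dist_eq_norm, ← inner_sub_right, ← sub_apply] at h2 ⊢
  have hT : ‖f i - a‖ ≤ R :=
    (norm_sub_le _ _).trans (add_le_add (h1.trans (le_abs_self r)) le_rfl)
  set T := f i - a
  have e : ⟪z, T y⟫_ℂ = ⟪z', T y'⟫_ℂ + (⟪z - z', T y⟫_ℂ + ⟪z', T (y - y')⟫_ℂ) := by
    simp only [inner_sub_left, inner_sub_right, map_sub]; ring
  have h3 : ‖⟪z - z', T y⟫_ℂ‖ ≤ ε / 3 := by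
    calc _ ≤ ‖z - z'‖ * ‖T y‖ := norm_inner_le_norm _ _
      _ ≤ (ε / 3 / (1 + R * ‖y‖)) * (1 + R * ‖y‖) := by
        rw [dist_eq_norm] at hzz
        gcongr
        linarith [T.le_of_opNorm_le hT y]
      _ = ε / 3 := by field_simp
  have h4 : ‖⟪z', T (y - y')⟫_ℂ‖ ≤ ε / 3 := by
    calc _ ≤ ‖z'‖ * ‖T (y - y')‖ := norm_inner_le_norm _ _
      _ ≤ ‖z'‖ * (R * ‖y - y'‖) := by gcongr; exact T.le_of_opNorm_le hT _
      _ = (‖z'‖ * R) * ‖y - y'‖ := by ring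
      _ ≤ (1 + ‖z'‖ * R) * (ε / 3 / (1 + ‖z'‖ * R)) := by
        rw [dist_eq_norm] at hyy
        gcongr
        linarith
      _ = ε / 3 := by field_simp
  rw [e]
  refine (norm_add_le _ _).trans_lt ?_
  have := norm_add_le ⟪z - z', T y⟫_ℂ ⟪z', T (y - y')⟫_ℂ
  linarith

end Contraction

/-! ### Faithful normal cyclic representations. -/

section Representation

variable {H : Type u} [NormedAddCommGroup H] [InnerProductSpace ℂ H] [CompleteSpace H]
  {K : Type u} [NormedAddCommGroup K] [InnerProductSpace ℂ K] [CompleteSpace K]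

/-- A faithful cyclic representation of a von Neumann algebra on `K`, whose cyclic vector
implements the functional `φ`. -/
structure FaithfulCyclicRep (S : VonNeumannAlgebra H) (φ : S.toStarSubalgebra →ₗ[ℂ] ℂ)
    (K : Type u) [NormedAddCommGroup K] [InnerProductSpace ℂ K] [CompleteSpace K] where
  π : S.toStarSubalgebra →⋆ₐ[ℂ] (K →L[ℂ] K)
  ξ : K
  apply_eq : ∀ a, φ a = ⟪ξ, π a ξ⟫_ℂ
  denseRange : DenseRange fun a => π a ξ
  norm_map : ∀ a, ‖π a‖ = ‖a‖

theorem exists_faithfulCyclicRep {S : VonNeumannAlgebra H} {φ : S.toStarSubalgebra →ₗ[ℂ] ℂ}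
    (hφ : ∀ a, 0 ≤ φ (star a * a)) (hφ' : IsNondegenerate φ) :
    ∃ (K : Type u) (_ : NormedAddCommGroup K) (_ : InnerProductSpace ℂ K) (_ : CompleteSpace K),
      Nonempty (FaithfulCyclicRep S φ K) := by
  let _ := cstarAlgebraVonNeumannAlgebra S
  obtain ⟨K, _, _, _, π, ξ, h1, h2⟩ := exists_gns (A := S.toStarSubalgebra) φ hφ
  -- The kernel of π consists of elements a with φ(bac) = 0 for all b and c; an injective
  -- ⋆-homomorphism of C⋆-algebras is isometric.
  have hinj : Function.Injective π := by
    rw [injective_iff_map_eq_zero]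
    intro a ha
    refine hφ' a fun b c => ?_
    rw [h1, map_mul, map_mul, ha]
    simp
  exact ⟨K, inferInstance, inferInstance, inferInstance,
    ⟨⟨π, ξ, h1, h2, fun a => NonUnitalStarAlgHom.norm_map π hinj a⟩⟩⟩

variable {S : VonNeumannAlgebra H} {φ : S.toStarSubalgebra →ₗ[ℂ] ℂ}

namespace FaithfulCyclicRep

variable (R : FaithfulCyclicRep S φ K)

theorem injective : Function.Injective R.π := by
  rw [injective_iff_map_eq_zero]
  intro a ha
  rw [← norm_eq_zero, ← R.norm_map, ha, norm_zero]

theorem inner_apply (a b c : S.toStarSubalgebra) :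
    ⟪R.π c R.ξ, R.π a (R.π b R.ξ)⟫_ℂ = φ (star c * a * b) := by
  rw [R.apply_eq, map_mul, map_mul, map_star, ContinuousLinearMap.star_eq_adjoint]
  simp [ContinuousLinearMap.adjoint_inner_right]

theorem inner_apply' (b c : S.toStarSubalgebra) :
    ⟪R.π c R.ξ, R.π b R.ξ⟫_ℂ = φ (star c * b) := by
  have := R.inner_apply 1 b c
  simpa using this

/-- The representation is normal if `φ` is. -/
theorem tendsto (hφ : IsNormal S φ) {F : Filter S.toStarSubalgebra} {a : S.toStarSubalgebra}
    (h : WTendsto F a) : BoundedWeakTendsto (fun b => R.π b) F (R.π a) := by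
  refine BoundedWeakTendsto.of_dense R.denseRange ?_ ?_
  · obtain ⟨r, hr⟩ := h.bounded
    refine ⟨r, hr.mono fun b hb => ?_⟩
    rw [R.norm_map]
    exact hb
  · rintro _ ⟨b, rfl⟩ _ ⟨c, rfl⟩
    simp only [R.inner_apply]
    have h2 := h.mul_mul (star c : S.toStarSubalgebra) b
    have h1 : WTendsto (map (fun d => star c * d * b) F) (star c * a * b) :=
      ⟨h2.bounded.imp fun r hr => eventually_map.mpr hr,
        fun y z => tendsto_map'_iff.mpr (h2.tendsto y z)⟩
    exact tendsto_map'_iff.mp (hφ.tendsto h1)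

/-- Limits can be recognized in a faithful normal representation. -/
theorem exists_wTendsto (hφ : IsNormal S φ) {U : Ultrafilter S.toStarSubalgebra} {b : K →L[ℂ] K}
    (h : BoundedWeakTendsto (fun a => R.π a) U b) :
    ∃ a, R.π a = b ∧ WTendsto (U : Filter S.toStarSubalgebra) a := by
  -- As π is isometric, U is already bounded in S and has a weak limit there; normality of π and
  -- uniqueness of limits identify its image with b.
  obtain ⟨a, ha⟩ := exists_wTendsto_ultrafilter U (by
    obtain ⟨r, hr⟩ := h.bounded
    exact ⟨r, hr.mono fun b hb => by rwa [R.norm_map] at hb⟩)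
  exact ⟨a, (R.tendsto hφ ha).unique h, ha⟩

end FaithfulCyclicRep

end Representation

/-! ### Pattern invariant moments and the shift projection. -/

section PatternInvariance

/-- The mixed moments `φ(x_{i_1} ⋯ x_{i_k})` depend only on which neighbouring indices agree. -/
def IsPatternInvariant {A : Type w} [Ring A] [Algebra ℂ A] (φ : A →ₗ[ℂ] ℂ) (x : ℕ → A) : Prop :=
  ∀ l : List (ℕ × ℕ), l.IsChain (fun p q => p.1 = q.1 ↔ p.2 = q.2) →
    φ (l.map fun p => x p.1).prod = φ (l.map fun p => x p.2).prod

theorem isChain_of_forall {α : Type*} {r : α → α → Prop} {l : List α}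
    (h : ∀ a ∈ l, ∀ b ∈ l, r a b) : l.IsChain r := by
  induction l with
  | nil => exact List.isChain_nil
  | cons a l ih =>
    cases l with
    | nil => exact List.isChain_singleton a
    | cons b l =>
      rw [List.isChain_cons_cons]
      exact ⟨h a (by simp) b (by simp),
        ih fun c hc d hd => h c (List.mem_cons_of_mem _ hc) d (List.mem_cons_of_mem _ hd)⟩

theorem isChain_append_of_forall {α : Type*} {r : α → α → Prop} {l m : List α}
    (hl : l.IsChain r) (hm : m.IsChain r) (h : ∀ a ∈ l, ∀ b ∈ m, r a b) : (l ++ m).IsChain r :=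
  List.isChain_append.mpr ⟨hl, hm, fun a ha b hb =>
    h a (List.mem_of_mem_getLast? ha) b (List.mem_of_mem_head? hb)⟩

/-- The middle list must be nonempty, otherwise l and n become neighbours. -/
theorem isChain_append_append_of_forall {α : Type*} {r : α → α → Prop} {l m n : List α}
    (hl : l.IsChain r) (hm : m.IsChain r) (hn : n.IsChain r) (hm0 : m ≠ [])
    (h : ∀ a ∈ l, ∀ b ∈ m, r a b) (h' : ∀ b ∈ m, ∀ c ∈ n, r b c) :
    (l ++ (m ++ n)).IsChain r := by
  refine List.isChain_append.mpr ⟨hl, isChain_append_of_forall hm hn h', fun a ha b hb =>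
    h a (List.mem_of_mem_getLast? ha) b ?_⟩
  obtain ⟨c, m, rfl⟩ := List.exists_cons_of_ne_nil hm0
  simp only [List.cons_append, List.head?_cons, Option.mem_def, Option.some.injEq] at hb
  simp [← hb]

theorem isChain_map_injective {f g : ℕ → ℕ} (hf : Function.Injective f)
    (hg : Function.Injective g) (w : List ℕ) :
    (w.map fun k => (f k, g k)).IsChain fun p q => (p.1 = q.1 ↔ p.2 = q.2) := by
  refine isChain_of_forall fun a ha b hb => ?_
  obtain ⟨k, -, rfl⟩ := List.mem_map.mp ha
  obtain ⟨l, -, rfl⟩ := List.mem_map.mp hb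
  simp [hf.eq_iff, hg.eq_iff]

theorem exists_forall_lt (w : List ℕ) : ∃ N : ℕ, ∀ k ∈ w, k < N := by
  induction w with
  | nil => exact ⟨0, by simp⟩
  | cons a l ih =>
    obtain ⟨N, hN⟩ := ih
    refine ⟨max N (a + 1), fun k hk => ?_⟩
    rcases List.mem_cons.mp hk with rfl | hk
    · omega
    · have := hN k hk; omega

theorem star_prod_map {A : Type*} [Monoid A] [StarMul A] {x : ℕ → A}
    (hx : ∀ i, IsSelfAdjoint (x i)) (w : List ℕ) :
    star (w.map x).prod = (w.reverse.map x).prod := by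
  induction w with
  | nil => simp
  | cons a w ih => simp [star_mul, ih, (hx a).star_eq]

section Adjoin

variable {A : Type w} [Ring A] [Algebra ℂ A] {x : ℕ → A}

theorem prod_map_mem_adjoin {s : Set ℕ} {w : List ℕ} (hw : w ≠ []) (hs : ∀ k ∈ w, k ∈ s) :
    (w.map x).prod ∈ NonUnitalAlgebra.adjoin ℂ (x '' s) := by
  induction w with
  | nil => exact absurd rfl hw
  | cons a w ih =>
    have ha : x a ∈ NonUnitalAlgebra.adjoin ℂ (x '' s) :=
      NonUnitalAlgebra.subset_adjoin ℂ ⟨a, hs a (by simp), rfl⟩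
    rcases eq_or_ne w [] with rfl | h
    · simpa using ha
    · rw [List.map_cons, List.prod_cons]
      exact mul_mem ha (ih h fun k hk => hs k (List.mem_cons_of_mem _ hk))

/-- The non-unital algebra generated by the `x_i` is spanned by the nonempty words. -/
theorem adjoin_image_le_span (s : Set ℕ) :
    (NonUnitalAlgebra.adjoin ℂ (x '' s)).toSubmodule ≤
      Submodule.span ℂ {a | ∃ w : List ℕ, w ≠ [] ∧ (∀ k ∈ w, k ∈ s) ∧ a = (w.map x).prod} := by
  rw [NonUnitalAlgebra.adjoin_eq_span]
  refine Submodule.span_mono fun a ha => ?_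
  induction ha using Subsemigroup.closure_induction with
  | mem a ha =>
    obtain ⟨k, hk, rfl⟩ := ha
    exact ⟨[k], by simp, by simpa using hk, by simp⟩
  | mul a b _ _ iha ihb =>
    obtain ⟨v, hv, hvs, rfl⟩ := iha
    obtain ⟨w, hw, hws, rfl⟩ := ihb
    refine ⟨v ++ w, by simp [hv], fun k hk => ?_, by simp⟩
    rcases List.mem_append.mp hk with h | h
    · exact hvs k h
    · exact hws k h

theorem star_mem_adjoin_image [StarRing A] [StarModule ℂ A] (hx : ∀ i, IsSelfAdjoint (x i))
    (s : Set ℕ) (a : A) (ha : a ∈ NonUnitalAlgebra.adjoin ℂ (x '' s)) :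
    star a ∈ NonUnitalAlgebra.adjoin ℂ (x '' s) := by
  induction ha using NonUnitalAlgebra.adjoin_induction with
  | mem a ha =>
    obtain ⟨k, hk, rfl⟩ := ha
    rw [(hx k).star_eq]
    exact NonUnitalAlgebra.subset_adjoin ℂ ⟨k, hk, rfl⟩
  | add a b _ _ iha ihb => rw [star_add]; exact add_mem iha ihb
  | zero => rw [star_zero]; exact zero_mem _
  | mul a b _ _ iha ihb => rw [star_mul]; exact mul_mem ihb iha
  | smul r a _ iha => rw [star_smul]; exact SMulMemClass.smul_mem _ iha

end Adjoin

variable {H : Type u} [NormedAddCommGroup H] [InnerProductSpace ℂ H] [CompleteSpace H]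
  {K : Type u} [NormedAddCommGroup K] [InnerProductSpace ℂ K] [CompleteSpace K]
  {S : VonNeumannAlgebra H} {φ : S.toStarSubalgebra →ₗ[ℂ] ℂ}

namespace FaithfulCyclicRep

variable (R : FaithfulCyclicRep S φ K) (x : ℕ → S.toStarSubalgebra)

/-- The vector `x_{i_1} ⋯ x_{i_k} ξ`. -/
def wordVec (w : List ℕ) : K := R.π (w.map x).prod R.ξ

theorem π_wordVec (v w : List ℕ) :
    R.π (v.map x).prod (R.wordVec x w) = R.wordVec x (v ++ w) := by
  simp [wordVec, List.map_append, List.prod_append]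

theorem π_wordVec_singleton (i : ℕ) (w : List ℕ) :
    R.π (x i) (R.wordVec x w) = R.wordVec x (i :: w) := by
  simpa using R.π_wordVec x [i] w

variable {x}

theorem inner_wordVec (hx : ∀ i, IsSelfAdjoint (x i)) (v w : List ℕ) :
    ⟪R.wordVec x v, R.wordVec x w⟫_ℂ = φ ((v.reverse ++ w).map x).prod := by
  rw [wordVec, wordVec, R.inner_apply', star_prod_map hx, List.map_append, List.prod_append]

theorem inner_wordVec_map (hx : ∀ i, IsSelfAdjoint (x i)) (hP : IsPatternInvariant φ x)
    {σ : ℕ → ℕ} (hσ : Function.Injective σ) (v w : List ℕ) :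
    ⟪R.wordVec x (v.map σ), R.wordVec x (w.map σ)⟫_ℂ = ⟪R.wordVec x v, R.wordVec x w⟫_ℂ := by
  rw [R.inner_wordVec hx, R.inner_wordVec hx]
  have := hP ((v.reverse ++ w).map fun k => (σ k, k))
    (isChain_map_injective hσ Function.injective_id _)
  simpa [Function.comp_def] using this

theorem π_adjoint_inner (hx : ∀ i, IsSelfAdjoint (x i)) (w : List ℕ) (y z : K) :
    ⟪y, R.π (w.map x).prod z⟫_ℂ = ⟪R.π (w.reverse.map x).prod y, z⟫_ℂ := by
  rw [← star_prod_map hx, map_star, ContinuousLinearMap.star_eq_adjoint,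
    ContinuousLinearMap.adjoint_inner_left]

/-- By Kaplansky density every a is a bounded weak limit of polynomials in the x_i; π preserves such
limits and closed subspaces are weakly closed. -/
theorem dense_span_wordVec (hφ : IsNormal S φ) (hx : ∀ i, IsSelfAdjoint (x i))
    (hgen : wotClosure (NonUnitalAlgebra.adjoin ℂ (Set.range x)) = ⊤) :
    Dense (Submodule.span ℂ (Set.range (R.wordVec x)) : Set K) := by
  set D := (Submodule.span ℂ (Set.range (R.wordVec x))).topologicalClosure with hD
  have key : ∀ a, R.π a R.ξ ∈ D := by
    intro a
    rw [← Set.image_univ] at hgen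
    have ha : a ∈ wotClosure (NonUnitalAlgebra.adjoin ℂ (x '' Set.univ)) := by
      rw [hgen]; trivial
    obtain ⟨F, hF, hFC, hFa⟩ :=
      exists_wTendsto_of_mem_wotClosure (star_mem_adjoin_image hx _) ha
    refine (R.tendsto hφ hFa).apply_mem_of_isClosed (Submodule.isClosed_topologicalClosure _) ?_
    filter_upwards [hFC] with c hc
    refine Submodule.le_topologicalClosure _ ?_
    refine Submodule.span_induction (p := fun c _ => R.π c R.ξ ∈
      Submodule.span ℂ (Set.range (R.wordVec x))) ?_ ?_ ?_ ?_ (adjoin_image_le_span _ hc)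
    · rintro _ ⟨w, -, -, rfl⟩
      exact Submodule.subset_span ⟨w, rfl⟩
    · simp
    · intro b c _ _ hb hc
      rw [map_add]
      exact add_mem hb hc
    · intro r b _ hb
      rw [map_smul]
      exact Submodule.smul_mem _ _ hb
  rw [dense_iff_closure_eq, ← Submodule.topologicalClosure_coe, ← hD, Set.eq_univ_iff_forall]
  intro y
  have h1 : closure (Set.range fun a => R.π a R.ξ) ⊆ D :=
    closure_minimal (Set.range_subset_iff.mpr key) (Submodule.isClosed_topologicalClosure _)
  exact h1 (R.denseRange y)

theorem ext_wordVec (hd : Dense (Submodule.span ℂ (Set.range (R.wordVec x)) : Set K))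
    {a b : K →L[ℂ] K}
    (h : ∀ v w, ⟪R.wordVec x v, a (R.wordVec x w)⟫_ℂ = ⟪R.wordVec x v, b (R.wordVec x w)⟫_ℂ) :
    a = b := by
  refine ContinuousLinearMap.ext_on hd ?_
  rintro _ ⟨w, rfl⟩
  rw [← sub_eq_zero]
  refine hd.eq_zero_of_inner_right ℂ fun y hy => ?_
  refine Submodule.span_induction (p := fun y _ =>
    ⟪y, a (R.wordVec x w) - b (R.wordVec x w)⟫_ℂ = 0) ?_ ?_ ?_ ?_ hy
  · rintro _ ⟨v, rfl⟩
    rw [inner_sub_right, h, sub_self]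
  · simp
  · intro y z _ _ h1 h2
    rw [inner_add_left, h1, h2, add_zero]
  · intro c y _ h1
    rw [inner_smul_left, h1, mul_zero]

/-- All the `x_i` have the same norm. -/
theorem norm_le_norm (hx : ∀ i, IsSelfAdjoint (x i)) (hP : IsPatternInvariant φ x)
    (hd : Dense (Submodule.span ℂ (Set.range (R.wordVec x)) : Set K)) (i j : ℕ) :
    ‖x i‖ ≤ ‖x j‖ := by
  let σ := Equiv.swap i j
  obtain ⟨V, hV, hVw⟩ := exists_contraction_of_inner_eq (p := R.wordVec x)
    (q := fun w => R.wordVec x (w.map σ))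
    (fun v w => R.inner_wordVec_map hx hP σ.injective v w) hd
  -- V implements the transposition of i and j on words and is its own inverse.
  have e : R.π (x i) = V * R.π (x j) * V := by
    refine ContinuousLinearMap.ext_on hd ?_
    rintro _ ⟨w, rfl⟩
    have hσ : σ ∘ σ = id := by funext k; simp [σ]
    simp [hVw, π_wordVec_singleton, hσ, σ]
  rw [← R.norm_map, ← R.norm_map, e]
  calc ‖V * R.π (x j) * V‖ ≤ ‖V‖ * ‖R.π (x j)‖ * ‖V‖ :=
        (norm_mul_le _ _).trans (mul_le_mul_of_nonneg_right (norm_mul_le _ _) (norm_nonneg _))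
    _ ≤ 1 * ‖R.π (x j)‖ * 1 := by gcongr
    _ = _ := by ring

/-- The projection onto the vectors that are invariant under the shift of the indices,
characterized by its values on words. -/
structure IsShiftProjection (x : ℕ → S.toStarSubalgebra) (Q : K →L[ℂ] K) : Prop where
  idem : Q * Q = Q
  selfAdjoint : ∀ y z, ⟪Q y, z⟫_ℂ = ⟪y, Q z⟫_ℂ
  inner_eq : ∀ (z : K) (w : List ℕ) (c : ℂ),
    (∀ᶠ N : ℕ in atTop, ⟪z, R.wordVec x (w.map (· + N))⟫_ℂ = c) → ⟪z, Q (R.wordVec x w)⟫_ℂ = c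

/-- Q projects onto the fixed vectors of the shift contraction U. Matrix coefficients of Birkhoff
averages of U are Cesàro means of ⟪z, U^N x_w ξ⟫, so an eventually constant value of the latter is
the coefficient of Q. -/
theorem exists_isShiftProjection (hx : ∀ i, IsSelfAdjoint (x i)) (hP : IsPatternInvariant φ x)
    (hd : Dense (Submodule.span ℂ (Set.range (R.wordVec x)) : Set K)) :
    ∃ Q : K →L[ℂ] K, R.IsShiftProjection x Q := by
  obtain ⟨U, hU, hUw⟩ := exists_contraction_of_inner_eq (p := R.wordVec x)
    (q := fun w => R.wordVec x (w.map (· + 1)))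
    (fun v w => R.inner_wordVec_map hx hP (add_left_injective 1) v w) hd
  have hUit : ∀ (N : ℕ) (w : List ℕ), U^[N] (R.wordVec x w) = R.wordVec x (w.map (· + N)) := by
    intro N
    induction N with
    | zero => intro w; simp
    | succ N ih =>
      intro w
      rw [Function.iterate_succ_apply', ih, hUw, List.map_map]
      rfl
  let L : Submodule ℂ K := U.eqLocus (1 : K →L[ℂ] K)
  refine ⟨L.starProjection, ?_, ?_, ?_⟩
  · exact isStarProjection_starProjection.isIdempotentElem
  · exact Submodule.inner_starProjection_left_eq_right L
  · intro z w c hc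
    have h1 : Tendsto (fun n => ⟪z, birkhoffAverage ℂ U _root_.id n (R.wordVec x w)⟫_ℂ) atTop
        (𝓝 ⟪z, L.starProjection (R.wordVec x w)⟫_ℂ) :=
      (continuous_const.inner continuous_id).continuousAt.tendsto.comp
        (U.tendsto_birkhoffAverage_orthogonalProjection hU (R.wordVec x w))
    have h2 : Tendsto (fun N : ℕ => ⟪z, R.wordVec x (w.map (· + N))⟫_ℂ) atTop (𝓝 c) :=
      tendsto_const_nhds.congr' (hc.mono fun _ h => h.symm)
    have h3 := h2.cesaro_smul
    refine tendsto_nhds_unique h1 (h3.congr fun n => ?_)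
    simp only [birkhoffAverage, birkhoffSum, hUit, id, inner_smul_right, inner_sum]
    rw [Complex.real_smul]
    simp

end FaithfulCyclicRep

end PatternInvariance

/-! ### Compression by the shift projection and the tail algebra. -/

section ShiftProjection

variable {H : Type u} [NormedAddCommGroup H] [InnerProductSpace ℂ H] [CompleteSpace H]
  {K : Type u} [NormedAddCommGroup K] [InnerProductSpace ℂ K] [CompleteSpace K]
  {S : VonNeumannAlgebra H} {φ : S.toStarSubalgebra →ₗ[ℂ] ℂ} {x : ℕ → S.toStarSubalgebra}

theorem mem_tailAlgebra_iff {a : S.toStarSubalgebra} :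
    a ∈ tailAlgebra x ↔ ∀ n, a ∈ wotClosure (NonUnitalAlgebra.adjoin ℂ (x '' Set.Ici n)) := by
  rw [tailAlgebra, NonUnitalAlgebra.mem_iInf]

namespace FaithfulCyclicRep.IsShiftProjection

variable {R : FaithfulCyclicRep S φ K} {Q : K →L[ℂ] K} (hQ : R.IsShiftProjection x Q)
include hQ

/-- The two copies of Q move the letters of b and c to infinity, away from w. Moving w away from b
and c produces the same pattern, provided that w separates b from c. -/
theorem inner_block (hx : ∀ i, IsSelfAdjoint (x i)) (hP : IsPatternInvariant φ x)
    {c w b : List ℕ} {N : ℕ} (hw : w ≠ []) (hc : ∀ k ∈ c, ∀ l ∈ w, k ≠ l + N)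
    (hb : ∀ k ∈ b, ∀ l ∈ w, k ≠ l + N) :
    ⟪R.wordVec x c, (Q * R.π (w.map x).prod * Q) (R.wordVec x b)⟫_ℂ =
      ⟪R.wordVec x c, R.π ((w.map (· + N)).map x).prod (R.wordVec x b)⟫_ℂ := by
  obtain ⟨M, hM⟩ := exists_forall_lt w
  change ⟪R.wordVec x c, Q (R.π (w.map x).prod (Q (R.wordVec x b)))⟫_ℂ = _
  rw [← hQ.selfAdjoint, R.π_adjoint_inner hx]
  refine hQ.inner_eq _ _ _ ?_
  filter_upwards [eventually_ge_atTop M] with i hi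
  rw [← R.π_adjoint_inner hx, R.π_wordVec, R.π_wordVec, ← inner_conj_symm,
    ← inner_conj_symm (R.wordVec x c)]
  congr 1
  refine hQ.inner_eq _ _ _ ?_
  filter_upwards [eventually_ge_atTop M] with j hj
  rw [← inner_conj_symm, ← inner_conj_symm _ (R.wordVec x c)]
  congr 1
  rw [R.inner_wordVec hx, R.inner_wordVec hx]
  have := hP (c.reverse.map (fun k => (k + j, k)) ++
    (w.map (fun l => (l, l + N)) ++ b.map (fun k => (k + i, k)))) ?_
  · simpa [Function.comp_def] using this
  · refine isChain_append_append_of_forall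
      (isChain_map_injective (add_left_injective j) Function.injective_id _)
      (isChain_map_injective Function.injective_id (add_left_injective N) _)
      (isChain_map_injective (add_left_injective i) Function.injective_id _) (by simpa) ?_ ?_
    · intro p hp q hq
      obtain ⟨k, hk, rfl⟩ := List.mem_map.mp hp
      obtain ⟨l, hl, rfl⟩ := List.mem_map.mp hq
      have h1 := hc k (by simpa using hk) l hl
      have h2 := hM l hl
      simp only [h1, iff_false]
      omega
    · intro p hp q hq
      obtain ⟨l, hl, rfl⟩ := List.mem_map.mp hp
      obtain ⟨k, hk, rfl⟩ := List.mem_map.mp hq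
      have h1 := hb k hk l hl
      have h2 := hM l hl
      simp only [h1.symm, iff_false]
      omega

theorem eventually_inner_block (hx : ∀ i, IsSelfAdjoint (x i)) (hP : IsPatternInvariant φ x)
    (c b : List ℕ) {w : List ℕ} (hw : w ≠ []) :
    ∀ᶠ N : ℕ in atTop, ⟪R.wordVec x c, (Q * R.π (w.map x).prod * Q) (R.wordVec x b)⟫_ℂ =
      ⟪R.wordVec x c, R.π ((w.map (· + N)).map x).prod (R.wordVec x b)⟫_ℂ := by
  obtain ⟨M, hM⟩ := exists_forall_lt c
  obtain ⟨M', hM'⟩ := exists_forall_lt b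
  filter_upwards [eventually_ge_atTop (M + M')] with N hN
  refine hQ.inner_block hx hP hw (fun k hk l _ => ?_) fun k hk l _ => ?_
  · have := hM k hk; omega
  · have := hM' k hk; omega

theorem apply_ξ : Q R.ξ = R.ξ := by
  have h : R.ξ = R.wordVec x [] := by simp [wordVec]
  refine ext_inner_left ℂ fun z => ?_
  rw [h]
  exact hQ.inner_eq z [] _ (Eventually.of_forall fun N => by simp)

variable (hx : ∀ i, IsSelfAdjoint (x i)) (hP : IsPatternInvariant φ x)
  (hd : Dense (Submodule.span ℂ (Set.range (R.wordVec x)) : Set K))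
include hx hP hd

/-- Source of boolean independence: Q shifts x_j and all later letters far away. The only
neighbouring pair whose relation could change is (i, j), and it consists of distinct indices before
and after. -/
theorem mul_mul_eq {i j : ℕ} (hij : i ≠ j) :
    R.π (x i) * Q * R.π (x j) = R.π (x i) * R.π (x j) := by
  refine R.ext_wordVec hd fun c b => ?_
  change ⟪R.wordVec x c, R.π (x i) (Q (R.π (x j) (R.wordVec x b)))⟫_ℂ =
    ⟪R.wordVec x c, R.π (x i) (R.π (x j) (R.wordVec x b))⟫_ℂ
  have h : ∀ z, ⟪R.wordVec x c, R.π (x i) z⟫_ℂ = ⟪R.wordVec x (i :: c), z⟫_ℂ := by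
    intro z
    have := R.π_adjoint_inner hx [i] (R.wordVec x c) z
    simpa [π_wordVec_singleton] using this
  rw [h, h, π_wordVec_singleton]
  refine hQ.inner_eq _ _ _ ?_
  filter_upwards [eventually_gt_atTop i] with N hN
  rw [R.inner_wordVec hx, R.inner_wordVec hx]
  have := hP ((i :: c).reverse.map (fun k => (k, k)) ++ (j :: b).map (fun k => (k + N, k))) ?_
  · simpa [Function.comp_def] using this
  · refine List.isChain_append.mpr
      ⟨isChain_map_injective Function.injective_id Function.injective_id _,
        isChain_map_injective (add_left_injective N) Function.injective_id _, ?_⟩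
    intro p hp q hq
    simp only [List.reverse_cons, List.map_append, List.map_cons, List.map_nil,
      List.getLast?_append, List.getLast?_singleton, Option.some_or, Option.mem_def,
      Option.some.injEq, List.head?_cons] at hp hq
    subst hp hq
    simp only [hij, iff_false]
    omega

/-- After a large shift, a power of x_i and the same power of x_j are constant blocks foreign to the
surrounding words, so they create the same pattern. -/
theorem conj_pow_eq (i j k : ℕ) : Q * R.π (x i) ^ k * Q = Q * R.π (x j) ^ k * Q := by
  rcases Nat.eq_zero_or_pos k with rfl | hk
  · simp
  have e : ∀ m, R.π (x m) ^ k = R.π ((List.replicate k m).map x).prod := by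
    intro m; simp
  have hne : ∀ m : ℕ, List.replicate k m ≠ [] := by
    intro m; simp; omega
  refine R.ext_wordVec hd fun c b => ?_
  rw [e, e]
  obtain ⟨M, hM⟩ := exists_forall_lt (c ++ b)
  obtain ⟨N, h1, h2, hN⟩ := ((hQ.eventually_inner_block hx hP c b (hne i)).and
    ((hQ.eventually_inner_block hx hP c b (hne j)).and (eventually_ge_atTop M))).exists
  rw [h1, h2, R.π_wordVec, R.π_wordVec, R.inner_wordVec hx, R.inner_wordVec hx]
  have := hP (c.reverse.map (fun k => (k, k)) ++
    ((List.replicate k (i + N, j + N)) ++ b.map (fun k => (k, k)))) ?_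
  · simpa [Function.comp_def] using this
  · refine isChain_append_append_of_forall
      (isChain_map_injective Function.injective_id Function.injective_id _)
      (isChain_of_forall ?_)
      (isChain_map_injective Function.injective_id Function.injective_id _)
      (by simp; omega) ?_ ?_
    · intro p hp q hq
      rw [List.eq_of_mem_replicate hp, List.eq_of_mem_replicate hq]
      simp
    · intro p hp q hq
      obtain ⟨l, hl, rfl⟩ := List.mem_map.mp hp
      have := hM l (by simp_all)
      rw [List.eq_of_mem_replicate hq]
      constructor <;> intro h <;> simp only at h <;> omega
    · intro p hp q hq
      obtain ⟨l, hl, rfl⟩ := List.mem_map.mp hq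
      have := hM l (by simp_all)
      rw [List.eq_of_mem_replicate hp]
      constructor <;> intro h <;> simp only at h <;> omega

/-- The elements of the tail algebra live on the range of the shift projection. -/
theorem conj_eq_of_mem_tailAlgebra (hφ : IsNormal S φ) {a : S.toStarSubalgebra}
    (ha : a ∈ tailAlgebra x) : Q * R.π a * Q = R.π a := by
  refine R.ext_wordVec hd fun c b => ?_
  obtain ⟨M, hM⟩ := exists_forall_lt (c ++ b)
  -- The approximating words have letters beyond those of b and c, so `inner_block` applies to them
  -- with shift 0.
  obtain ⟨F, hF, hFC, hFa⟩ := exists_wTendsto_of_mem_wotClosure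
    (star_mem_adjoin_image hx _) (mem_tailAlgebra_iff.mp ha M)
  have h1 := R.tendsto hφ hFa
  refine tendsto_nhds_unique ((h1.mul_mul Q Q).tendsto _ _) ((h1.tendsto _ _).congr' ?_)
  filter_upwards [hFC] with d hd'
  refine Submodule.span_induction (p := fun d _ =>
    ⟪R.wordVec x c, R.π d (R.wordVec x b)⟫_ℂ =
      ⟪R.wordVec x c, (Q * R.π d * Q) (R.wordVec x b)⟫_ℂ) ?_ ?_ ?_ ?_
      (adjoin_image_le_span _ hd')
  · rintro _ ⟨w, hw, hwM, rfl⟩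
    have := hQ.inner_block hx hP (c := c) (b := b) (N := 0) hw
      (fun k hk l hl h => by
        have h1 := hM k (by simp [hk])
        have h2 : M ≤ l := hwM l hl
        omega)
      (fun k hk l hl h => by
        have h1 := hM k (by simp [hk])
        have h2 : M ≤ l := hwM l hl
        omega)
    simpa using this.symm
  · simp
  · intro d e _ _ h1 h2
    simp only [map_add, mul_add, add_mul, add_apply, inner_add_right, h1, h2]
  · intro r d _ h
    have e1 : Q * R.π (r • d) * Q = r • (Q * R.π d * Q) := by
      rw [map_smul, mul_smul_comm, smul_mul_assoc]
    rw [e1, map_smul, smul_apply, smul_apply, inner_smul_right, inner_smul_right, h]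

/-- The element is an ultrafilter limit of the shifts of w, which are bounded since all x_i have the
same norm. The letters leave every initial segment, and the matrix coefficients are eventually those
of the compression. -/
theorem exists_mem_tailAlgebra_of_word (hφ : IsNormal S φ) {w : List ℕ} (hw : w ≠ []) :
    ∃ t ∈ tailAlgebra x, R.π t = Q * R.π (w.map x).prod * Q := by
  have hbd : ∀ w : List ℕ, ∃ r : ℝ, ∀ N : ℕ, ‖((w.map (· + N)).map x).prod‖ ≤ r := by
    intro w
    induction w with
    | nil => exact ⟨‖(1 : S.toStarSubalgebra)‖, by simp⟩
    | cons a w ih =>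
      obtain ⟨r, hr⟩ := ih
      refine ⟨‖x 0‖ * r, fun N => ?_⟩
      rw [List.map_cons, List.map_cons, List.prod_cons]
      refine (norm_mul_le _ _).trans ?_
      gcongr
      · exact R.norm_le_norm hx hP hd _ _
      · exact hr N
  let V : Ultrafilter ℕ := Ultrafilter.of atTop
  have hV : (V : Filter ℕ) ≤ atTop := Ultrafilter.of_le atTop
  let f : ℕ → S.toStarSubalgebra := fun N => ((w.map (· + N)).map x).prod
  obtain ⟨t, ht⟩ := exists_wTendsto_ultrafilter (V.map f) (by
    obtain ⟨r, hr⟩ := hbd w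
    exact ⟨r, eventually_map.mpr (Eventually.of_forall hr)⟩)
  refine ⟨t, mem_tailAlgebra_iff.mpr fun n => ?_, ?_⟩
  · refine mem_wotClosure_of_wTendsto ht ?_
    refine eventually_map.mpr (hV ?_)
    filter_upwards [eventually_ge_atTop n] with N hN
    refine le_wotClosure _ (prod_map_mem_adjoin (by simpa using hw) fun k hk => ?_)
    obtain ⟨l, -, rfl⟩ := List.mem_map.mp hk
    exact le_trans hN (Nat.le_add_left _ _)
  · refine R.ext_wordVec hd fun c b => ?_
    have h1 := (R.tendsto hφ ht).tendsto (R.wordVec x b) (R.wordVec x c)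
    have h2 : Tendsto (fun N => ⟪R.wordVec x c, R.π (f N) (R.wordVec x b)⟫_ℂ) V
        (𝓝 ⟪R.wordVec x c, R.π t (R.wordVec x b)⟫_ℂ) := tendsto_map'_iff.mp h1
    refine tendsto_nhds_unique h2 (tendsto_const_nhds.congr' ?_)
    exact hV (hQ.eventually_inner_block hx hP c b hw)

/-- The compressions of a bounded approximating filter converge weakly to that of a; lifting the
limit through the faithful representation keeps it in the weakly closed tail algebra. -/
theorem exists_mem_tailAlgebra (hφ : IsNormal S φ)
    (hgen : wotClosure (NonUnitalAlgebra.adjoin ℂ (Set.range x)) = ⊤) (a : S.toStarSubalgebra) :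
    ∃ t ∈ tailAlgebra x, R.π t = Q * R.π a * Q := by
  have h1 : ∀ c ∈ NonUnitalAlgebra.adjoin ℂ (x '' Set.univ),
      ∃ t ∈ tailAlgebra x, R.π t = Q * R.π c * Q := by
    intro c hc
    refine Submodule.span_induction (p := fun c _ => ∃ t ∈ tailAlgebra x,
      R.π t = Q * R.π c * Q) ?_ ?_ ?_ ?_ (adjoin_image_le_span _ hc)
    · rintro _ ⟨w, hw, -, rfl⟩
      exact hQ.exists_mem_tailAlgebra_of_word hx hP hd hφ hw
    · exact ⟨0, zero_mem _, by simp⟩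
    · rintro c d - - ⟨s, hs, hs'⟩ ⟨t, ht, ht'⟩
      exact ⟨s + t, add_mem hs ht, by rw [map_add, map_add, hs', ht', mul_add, add_mul]⟩
    · rintro r c - ⟨t, ht, ht'⟩
      exact ⟨r • t, SMulMemClass.smul_mem _ ht, by
        rw [map_smul, map_smul, ht', mul_smul_comm, smul_mul_assoc]⟩
  choose! g hgT hgπ using h1
  rw [← Set.image_univ] at hgen
  obtain ⟨F, hF, hFC, hFa⟩ := exists_wTendsto_of_mem_wotClosure
    (star_mem_adjoin_image hx _) (show a ∈ wotClosure _ by rw [hgen]; trivial)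
  let U : Ultrafilter S.toStarSubalgebra := Ultrafilter.of F
  have hUF : (U : Filter _) ≤ F := Ultrafilter.of_le F
  have h2 := (R.tendsto hφ (hFa.mono hUF)).mul_mul Q Q
  have hUC := hFC.filter_mono hUF
  have h3 : BoundedWeakTendsto (fun a => R.π a) (U.map g : Ultrafilter _) (Q * R.π a * Q) := by
    obtain ⟨r, hr⟩ := h2.bounded
    refine ⟨⟨r, eventually_map.mpr ?_⟩, fun y z => tendsto_map'_iff.mpr ?_⟩
    · filter_upwards [hr, hUC] with c h4 h5
      rwa [hgπ c h5]
    · refine (h2.tendsto y z).congr' ?_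
      filter_upwards [hUC] with c h5
      simp only [Function.comp_apply, hgπ c h5]
  obtain ⟨t, ht, htU⟩ := R.exists_wTendsto hφ h3
  refine ⟨t, mem_tailAlgebra_iff.mpr fun n => mem_wotClosure_of_wTendsto htU ?_, ht⟩
  refine eventually_map.mpr ?_
  filter_upwards [hUC] with c hc
  exact mem_tailAlgebra_iff.mp (hgT c hc) n

end FaithfulCyclicRep.IsShiftProjection

end ShiftProjection

/-! ### Evaluation of 𝒯-polynomials and construction of the expectation. -/

section ConditionalExpectation

section Evaluation

variable {A : Type w} [Ring A] [Algebra ℂ A] (B : NonUnitalSubalgebra ℂ A) (y : A)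

/-- The evaluation of `𝓑`-polynomials as an algebra homomorphism. -/
def evalHom : BPoly B →ₐ[ℂ] A := BPoly.eval (NonUnitalSubalgebraClass.subtype B) y

theorem evalAt_eq_evalHom (p : BPoly B) : evalAt B y p = evalHom B y p := rfl

@[simp] theorem evalHom_X : evalHom B y (BPoly.X B) = y := by
  simp [evalHom, BPoly.eval, BPoly.X]

@[simp] theorem evalHom_C (b : B) : evalHom B y (BPoly.C B b) = b := by
  simp [evalHom, BPoly.eval, BPoly.C]

theorem BPoly.induction {p : BPoly B → Prop} (hX : p (BPoly.X B)) (hC : ∀ b, p (BPoly.C B b))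
    (hs : ∀ c : ℂ, p (algebraMap ℂ _ c)) (hadd : ∀ q r, p q → p r → p (q + r))
    (hmul : ∀ q r, p q → p r → p (q * r)) (q : BPoly B) : p q := by
  obtain ⟨q, rfl⟩ := RingQuot.mkAlgHom_surjective ℂ (BPolyRel B) q
  induction q using FreeAlgebra.induction with
  | grade0 c => rw [AlgHom.commutes]; exact hs c
  | grade1 o =>
    cases o with
    | none => exact hX
    | some b => exact hC b
  | mul q r hq hr => rw [map_mul]; exact hmul _ _ hq hr
  | add q r hq hr => rw [map_add]; exact hadd _ _ hq hr

end Evaluation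

section Annihilation

variable {A : Type w} [Ring A] [Algebra ℂ A] {B : NonUnitalSubalgebra ℂ A} {x : A}
  {D : Type v} [Ring D] [Algebra ℂ D] (π : A →ₐ[ℂ] D)

/-- Each monomial ends in X b with b a coefficient or a scalar, and either case kills y. A constant
term would not. -/
theorem map_evalHom_mul_eq_zero {p : BPoly B} (hp : p ∈ BPoly.withoutConstantTerm B) {y : D}
    (hx : π x * y = 0) (hB : ∀ b ∈ B, π b * y = 0) : π (evalHom B x p) * y = 0 := by
  refine Submodule.span_induction (p := fun p _ => π (evalHom B x p) * y = 0) ?_ ?_ ?_ ?_ hp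
  · rintro _ ⟨b₀, -, bs, hbs, hb, rfl⟩
    rw [← List.dropLast_append_getLast hbs]
    have hlast := hb _ (List.getLast_mem hbs)
    have h : π (evalHom B x (BPoly.X B * bs.getLast hbs)) * y = 0 := by
      rw [map_mul, evalHom_X, map_mul, mul_assoc]
      rcases hlast with ⟨b, hb⟩ | ⟨c, hc⟩
      · rw [← hb, evalHom_C, hB b b.2, mul_zero]
      · rw [← hc]
        simp [hx]
    rw [List.map_append, List.prod_append, List.map_singleton, List.prod_singleton, map_mul,
      map_mul, map_mul, map_mul, mul_assoc, mul_assoc, h, mul_zero, mul_zero]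
  · simp
  · intro p q _ _ h1 h2
    rw [map_add, map_add, add_mul, h1, h2, add_zero]
  · intro c p _ h
    rw [map_smul, map_smul, smul_mul_assoc, h, smul_zero]

theorem mul_map_evalHom_eq_zero {p : BPoly B} (hp : p ∈ BPoly.withoutConstantTerm B) {y : D}
    (hx : y * π x = 0) (hB : ∀ b ∈ B, y * π b = 0) : y * π (evalHom B x p) = 0 := by
  refine Submodule.span_induction (p := fun p _ => y * π (evalHom B x p) = 0) ?_ ?_ ?_ ?_ hp
  · rintro _ ⟨b₀, hb₀, bs, hbs, -, rfl⟩
    obtain ⟨b, bs, rfl⟩ := List.exists_cons_of_ne_nil hbs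
    rw [List.map_cons, List.prod_cons, mul_assoc, map_mul, map_mul, map_mul, map_mul, evalHom_X]
    rcases hb₀ with ⟨b, rfl⟩ | ⟨c, rfl⟩
    · rw [evalHom_C, ← mul_assoc, hB b b.2, zero_mul]
    · simp only [map_smul, map_one, smul_mul_assoc, one_mul, mul_smul_comm]
      rw [← mul_assoc, hx, zero_mul, smul_zero]
  · simp
  · intro p q _ _ h1 h2
    rw [map_add, map_add, mul_add, h1, h2, add_zero]
  · intro c p _ h
    rw [map_smul, map_smul, mul_smul_comm, h, smul_zero]

end Annihilation

variable {H : Type u} [NormedAddCommGroup H] [InnerProductSpace ℂ H] [CompleteSpace H]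
  {K : Type u} [NormedAddCommGroup K] [InnerProductSpace ℂ K] [CompleteSpace K]
  {S : VonNeumannAlgebra H} {φ : S.toStarSubalgebra →ₗ[ℂ] ℂ} {x : ℕ → S.toStarSubalgebra}

/-- The compression of an operator by `Q`, for `x` moved by the identical distribution. -/
theorem conj_evalHom_eq {A : Type w} [Ring A] [Algebra ℂ A] {B : NonUnitalSubalgebra ℂ A}
    {D : Type v} [Ring D] [Algebra ℂ D] (π : A →ₐ[ℂ] D) {Q : D} {y z : A}
    (hB : ∀ b ∈ B, Q * π b * Q = π b) (hyz : ∀ k : ℕ, Q * π y ^ k * Q = Q * π z ^ k * Q)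
    (p : BPoly B) : Q * π (evalHom B y p) * Q = Q * π (evalHom B z p) * Q := by
  -- The induction builds a polynomial from the left and carries a pending power of the variable. A
  -- coefficient b = Q b Q cuts the product at Q, so that this power is compressed by itself and
  -- `hyz` applies.
  let G : BPoly B → Prop := fun r => ∀ k : ℕ,
    Q * (π y ^ k * π (evalHom B y r)) * Q = Q * (π z ^ k * π (evalHom B z r)) * Q
  have key : ∀ p r, G r → G (p * r) := by
    intro p
    induction p using BPoly.induction with
    | hX =>
      intro r hr k
      have := hr (k + 1)
      simpa [pow_succ, mul_assoc] using this
    | hC b =>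
      intro r hr k
      have e : ∀ w : A, Q * (π w ^ k * π (evalHom B w (BPoly.C B b * r))) * Q =
          (Q * π w ^ k * Q) * π b * (Q * (π w ^ 0 * π (evalHom B w r)) * Q) := by
        intro w
        rw [map_mul, map_mul, evalHom_C]
        conv_lhs => rw [← hB b b.2]
        simp only [pow_zero, one_mul, mul_assoc]
      rw [e, e, hyz, hr 0]
    | hs c =>
      intro r hr k
      have := hr k
      simp only [Algebra.algebraMap_eq_smul_one, smul_mul_assoc, one_mul, map_smul, mul_smul_comm,
        this]
    | hadd p q hp hq =>
      intro r hr k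
      have h1 := hp r hr k
      have h2 := hq r hr k
      rw [add_mul, map_add, map_add, map_add, map_add, mul_add, mul_add, mul_add, mul_add, add_mul,
        add_mul, h1, h2]
    | hmul p q hp hq =>
      intro r hr
      rw [mul_assoc]
      exact hp _ (hq r hr)
  have h1 : G 1 := fun k => by simpa using hyz k
  have := key p 1 h1 0
  simpa using this

/-- Compressions are multiplicative along products with consecutive factors `a`, `b` such that
`a * b = a * Q * b`. -/
theorem conj_list_prod_eq {D : Type v} [Ring D] {Q : D} (hQ : Q * Q = Q) {l : List D} (hl : l ≠ [])
    (hc : l.IsChain fun a b => a * Q * b = a * b) :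
    Q * l.prod * Q = (l.map fun a => Q * a * Q).prod := by
  induction l with
  | nil => exact absurd rfl hl
  | cons a l ih =>
    cases l with
    | nil => simp
    | cons b l =>
      rw [List.isChain_cons_cons] at hc
      have := ih (by simp) hc.2
      rw [List.map_cons, List.prod_cons (a := Q * a * Q), ← this, List.prod_cons, List.prod_cons]
      calc Q * (a * (b * l.prod)) * Q = Q * (a * b) * l.prod * Q := by simp only [mul_assoc]
        _ = Q * a * Q * b * l.prod * Q := by rw [← hc.1]; simp only [mul_assoc]
        _ = Q * a * (Q * Q) * b * l.prod * Q := by rw [hQ]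
        _ = _ := by simp only [mul_assoc]

theorem exists_conditionalExpectation (hφ : IsNormalState S φ) (hφ' : IsNondegenerate φ)
    (hx : ∀ i, IsSelfAdjoint (x i))
    (hgen : wotClosure (NonUnitalAlgebra.adjoin ℂ (Set.range x)) = ⊤)
    (hP : IsPatternInvariant φ x) :
    ∃ E : S.toStarSubalgebra →ₗ[ℂ] tailAlgebra x,
      IsConditionalExpectation (tailAlgebra x) E ∧
      (∀ a, φ (E a) = φ a) ∧
      IsNormal S (fun a => toWOT S (E a)) ∧
      IsIdenticallyDistributed (tailAlgebra x) E x ∧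
      IsBooleanIndependent (tailAlgebra x) E x := by
  obtain ⟨K, _, _, _, ⟨R⟩⟩ := exists_faithfulCyclicRep hφ.nonneg hφ'
  have hd := R.dense_span_wordVec hφ.normal hx hgen
  obtain ⟨Q, hQ⟩ := R.exists_isShiftProjection hx hP hd
  choose e he heπ using hQ.exists_mem_tailAlgebra hx hP hd hφ.normal hgen
  have hT : ∀ b ∈ tailAlgebra x, Q * R.π b * Q = R.π b := fun b hb =>
    hQ.conj_eq_of_mem_tailAlgebra hx hP hd hφ.normal hb
  have hTQ : ∀ b ∈ tailAlgebra x, R.π b * Q = R.π b := fun b hb => by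
    rw [← hT b hb, mul_assoc, hQ.idem]
  have hQT : ∀ b ∈ tailAlgebra x, Q * R.π b = R.π b := fun b hb => by
    rw [← hT b hb, ← mul_assoc, ← mul_assoc, hQ.idem]
  let E : S.toStarSubalgebra →ₗ[ℂ] tailAlgebra x :=
    { toFun := fun a => ⟨e a, he a⟩
      map_add' := fun a b => Subtype.ext <| R.injective <| by
        change R.π (e (a + b)) = R.π (e a + e b)
        rw [map_add, heπ, heπ, heπ, map_add, mul_add, add_mul]
      map_smul' := fun c a => Subtype.ext <| R.injective <| by
        change R.π (e (c • a)) = R.π (c • e a)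
        rw [map_smul, heπ, heπ, map_smul, mul_smul_comm, smul_mul_assoc] }
  have hE : ∀ a, R.π (E a : S.toStarSubalgebra) = Q * R.π a * Q := heπ
  refine ⟨E, ⟨fun b₁ b₂ a => ?_, fun b => ⟨b, ?_⟩⟩, fun a => ?_, ?_, fun i j p => ?_,
    fun l hl hc hp => ?_⟩
  · refine Subtype.ext (R.injective ?_)
    change R.π (E (b₁ * a * b₂) : S.toStarSubalgebra) =
      R.π ((b₁ : S.toStarSubalgebra) * (E a : S.toStarSubalgebra) * (b₂ : S.toStarSubalgebra))
    simp only [hE, map_mul]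
    calc Q * (R.π b₁ * R.π a * R.π b₂) * Q = (Q * R.π b₁) * R.π a * (R.π b₂ * Q) := by
          simp only [mul_assoc]
      _ = (R.π b₁ * Q) * R.π a * (Q * R.π b₂) := by
          rw [hQT _ b₁.2, hTQ _ b₂.2, hTQ _ b₁.2, hQT _ b₂.2]
      _ = _ := by simp only [mul_assoc]
  · refine Subtype.ext (R.injective ?_)
    rw [hE, hT _ b.2]
  · rw [R.apply_eq, R.apply_eq, hE]
    change ⟪R.ξ, Q (R.π a (Q R.ξ))⟫_ℂ = _
    rw [hQ.apply_ξ, ← hQ.selfAdjoint, hQ.apply_ξ]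
  · refine isNormal_of_tendsto fun U a ha => ?_
    have h1 := (R.tendsto hφ.normal ha).mul_mul Q Q
    let f : S.toStarSubalgebra → S.toStarSubalgebra := fun b => E b
    have h2 : BoundedWeakTendsto (fun b => R.π b) (U.map f : Ultrafilter _) (R.π (f a)) := by
      rw [show R.π (f a) = Q * R.π a * Q from hE a]
      obtain ⟨r, hr⟩ := h1.bounded
      refine ⟨⟨r, eventually_map.mpr (hr.mono fun b hb => ?_)⟩, fun y z => tendsto_map'_iff.mpr ?_⟩
      · rwa [hE]
      · refine (h1.tendsto y z).congr fun b => ?_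
        simp only [Function.comp_apply, f, hE]
    obtain ⟨t, ht, htU⟩ := R.exists_wTendsto hφ.normal h2
    rw [R.injective ht] at htU
    exact tendsto_map'_iff.mp htU.tendsto_wot
  · refine Subtype.ext (R.injective ?_)
    rw [hE, hE]
    exact conj_evalHom_eq (R.π : S.toStarSubalgebra →ₐ[ℂ] (K →L[ℂ] K)) hT
      (hQ.conj_pow_eq hx hP hd i j) p
  · apply R.injective
    rw [hE, map_list_prod, map_list_prod, List.map_map, List.map_map]
    rw [conj_list_prod_eq hQ.idem (by simpa using hl), List.map_map]
    · congr 1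
      refine List.map_congr_left fun q _ => ?_
      simp only [Function.comp_apply, hE]
    · rw [List.isChain_map]
      refine hc.imp_of_mem_imp fun q r hq hr hqr => ?_
      let π : S.toStarSubalgebra →ₐ[ℂ] (K →L[ℂ] K) := R.π
      let p' : K →L[ℂ] K := π (evalHom (tailAlgebra x) (x q.1) q.2)
      let r' : K →L[ℂ] K := π (evalHom (tailAlgebra x) (x r.1) r.2)
      -- 1 - Q annihilates the tail algebra from both sides and x_i (1 - Q) x_j = 0. This extends to
      -- polynomials without constant term one side at a time.
      have h1 : (π (x q.1) * (1 - Q)) * r' = 0 := by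
        refine mul_map_evalHom_eq_zero π (hp r hr) ?_ fun b hb => ?_
        · rw [mul_sub, mul_one, sub_mul, sub_eq_zero]
          exact (hQ.mul_mul_eq hx hP hd hqr).symm
        · rw [mul_assoc, sub_mul, one_mul, show Q * π b = π b from hQT b hb, sub_self, mul_zero]
      have h2 : p' * ((1 - Q) * r') = 0 := by
        refine map_evalHom_mul_eq_zero π (hp q hq) ?_ fun b hb => ?_
        · rw [← mul_assoc, h1]
        · rw [← mul_assoc, mul_sub, mul_one, show π b * Q = π b from hTQ b hb, sub_self, zero_mul]
      change p' * Q * r' = p' * r'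
      rw [← mul_assoc, mul_sub, mul_one, sub_mul, sub_eq_zero] at h2
      exact h2.symm

end ConditionalExpectation

/-! ### From boolean invariance to pattern invariance. -/

section BooleanInvariance

section Coaction

variable {A : Type w} [Ring A] [Algebra ℂ A] {φ : A →ₗ[ℂ] ℂ} {x : ℕ → A}

theorem basisFreeMonoid_apply {ι : Type*} (i : FreeMonoid ι) :
    FreeAlgebra.basisFreeMonoid ℂ ι i = (i.toList.map (FreeAlgebra.ι ℂ)).prod := by
  simp [FreeAlgebra.basisFreeMonoid, FreeAlgebra.equivMonoidAlgebraFreeMonoid,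
    FreeMonoid.lift_apply]

theorem ofFn_get_eq_zipWith {α β γ : Type*} (f : α → β → γ) (i : List β)
    (j : Fin i.length → α) :
    List.ofFn (fun t => f (j t) (i.get t)) = List.zipWith f (List.ofFn j) i := by
  apply List.ext_get <;> simp

/-- Both sides of the invariance condition are linear in the polynomial and words form a basis. -/
theorem isBooleanInvariant_iff : IsBooleanInvariant φ x ↔ ∀ (n : ℕ) (i : List (Fin n)),
    φ (i.map fun k : Fin n => x k).prod • Bs.P n =
      ∑ j : Fin i.length → Fin n, φ ((List.ofFn j).map fun k : Fin n => x k).prod •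
        (Bs.P n * (List.zipWith (Bs.u n) (List.ofFn j) i).prod * Bs.P n) := by
  refine forall_congr' fun n => ?_
  set μ := jointDistribution φ (fun i : Fin n => x i) with hμ
  have hμw : ∀ i : List (Fin n), μ (i.map (FreeAlgebra.ι ℂ)).prod =
      φ (i.map fun k : Fin n => x k).prod := by
    intro i
    simp only [hμ, jointDistribution, LinearMap.comp_apply, AlgHom.toLinearMap_apply,
      map_list_prod, List.map_map]
    congr 3
    funext k
    simp
  have key : ∀ i : FreeMonoid (Fin n),
      (TensorProduct.lid ℂ (BooleanBs n) (μ.rTensor (BooleanBs n)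
        (linearCoaction n (FreeAlgebra.basisFreeMonoid ℂ (Fin n) i))) : Bs n) =
      ∑ j : Fin i.toList.length → Fin n, φ ((List.ofFn j).map fun k : Fin n => x k).prod •
        (Bs.P n * (List.zipWith (Bs.u n) (List.ofFn j) i.toList).prod * Bs.P n) := by
    intro i
    rw [linearCoaction, Module.Basis.constr_basis, map_sum, map_sum, AddSubmonoidClass.coe_finsetSum]
    refine Finset.sum_congr rfl fun j _ => ?_
    rw [LinearMap.rTensor_tmul, TensorProduct.lid_tmul, ofFn_get_eq_zipWith]
    have : (List.ofFn fun t => FreeAlgebra.ι ℂ (j t)) =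
        (List.ofFn j).map (FreeAlgebra.ι ℂ) := by
      rw [List.map_ofFn]; rfl
    rw [this, hμw]
    rfl
  constructor
  · intro h i
    have h1 := congrArg (Subtype.val) (h (FreeAlgebra.basisFreeMonoid ℂ (Fin n)
      (FreeMonoid.ofList i)))
    rw [key, basisFreeMonoid_apply, FreeMonoid.toList_ofList, hμw] at h1
    exact h1
  · intro h p
    let f : FreeAlgebra ℂ (Fin n) →ₗ[ℂ] BooleanBs n := μ.smulRight (BooleanBs.unit n)
    let g : FreeAlgebra ℂ (Fin n) →ₗ[ℂ] BooleanBs n :=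
      (TensorProduct.lid ℂ (BooleanBs n)).toLinearMap ∘ₗ μ.rTensor (BooleanBs n) ∘ₗ
        linearCoaction n
    have : f = g := by
      refine (FreeAlgebra.basisFreeMonoid ℂ (Fin n)).ext fun i => Subtype.ext ?_
      refine Eq.trans ?_ (key i).symm
      rw [← h i.toList, ← hμw, ← basisFreeMonoid_apply]
      rfl
    exact LinearMap.congr_fun this p

end Coaction

section Realization

/-- Vectors spanning the ranges of rank one projections that satisfy the relations of `B_s(n)`,
with a Gram matrix that sees only whether the second indices agree. -/
structure BsVectors (n : ℕ) (K : Type) [NormedAddCommGroup K] [InnerProductSpace ℂ K] where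
  e : Fin n → Fin n → K
  v : K
  v_ne : v ≠ 0
  row : ∀ i k l, k ≠ l → ⟪e i k, e i l⟫_ℂ = 0
  column : ∀ i k l, k ≠ l → ⟪e k i, e l i⟫_ℂ = 0
  gram : ∀ j j' i i' k k', (i = i' ↔ k = k') → ⟪e j i, e j' i'⟫_ℂ = ⟪e j k, e j' k'⟫_ℂ
  gram_v : ∀ j i k, ⟪e j i, v⟫_ℂ = ⟪e j k, v⟫_ℂ
  sum_eq : ∀ i, ∑ k, (⟪e k i, v⟫_ℂ / ((‖e k i‖ ^ 2 : ℝ) : ℂ)) • e k i = v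

variable {n : ℕ} {K : Type} [NormedAddCommGroup K] [InnerProductSpace ℂ K] [CompleteSpace K]

theorem starProjection_singleton_apply (a w : K) : (ℂ ∙ a).starProjection w =
    (⟪a, w⟫_ℂ / ((‖a‖ ^ 2 : ℝ) : ℂ)) • a := by
  rw [Submodule.starProjection_singleton]; rfl

theorem starProjection_singleton_mul_eq_zero {a b : K} (h : ⟪a, b⟫_ℂ = 0) :
    (ℂ ∙ a).starProjection * (ℂ ∙ b).starProjection = 0 := by
  ext w
  change (ℂ ∙ a).starProjection ((ℂ ∙ b).starProjection w) = 0
  rw [starProjection_singleton_apply b, map_smul, starProjection_singleton_apply, h]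
  simp

/-- The realization of the relations of `B_s(n)` by rank one projections. -/
def BsVectors.rep (V : BsVectors n K) : BsRep n where
  carrier := K →L[ℂ] K
  nontrivial := ⟨1, 0, fun h => V.v_ne (by simpa using congrArg (fun T : K →L[ℂ] K => T V.v) h)⟩
  u j i := (ℂ ∙ V.e j i).starProjection
  P := (ℂ ∙ V.v).starProjection
  relations :=
    { isStarProjection_u := fun _ _ => isStarProjection_starProjection
      isStarProjection_P := isStarProjection_starProjection
      row_orthogonal := fun i k l h => starProjection_singleton_mul_eq_zero (V.row i k l h)
      column_orthogonal := fun i k l h => starProjection_singleton_mul_eq_zero (V.column i k l h)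
      invariant := fun i => by
        ext w
        rw [sum_apply]
        change (ℂ ∙ V.v).starProjection w =
          ∑ k, (ℂ ∙ V.e k i).starProjection ((ℂ ∙ V.v).starProjection w)
        rw [starProjection_singleton_apply V.v]
        simp only [map_smul]
        rw [← Finset.smul_sum]
        congr 1
        conv_lhs => rw [← V.sum_eq i]
        simp only [starProjection_singleton_apply] }

theorem BsVectors.norm_sq_eq (V : BsVectors n K) (j i k : Fin n) :
    ((‖V.e j i‖ ^ 2 : ℝ) : ℂ) = ((‖V.e j k‖ ^ 2 : ℝ) : ℂ) := by
  have := V.gram j j i i k k (by simp)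
  rw [inner_self_eq_norm_sq_to_K, inner_self_eq_norm_sq_to_K] at this
  rw [Complex.ofReal_pow, Complex.ofReal_pow]
  exact this

/-- Each rank one projection maps a multiple of the next vector to a multiple of its own. The scalar
is a ratio of Gram entries, which see only whether neighbouring second indices agree. -/
theorem BsVectors.exists_prod_apply (V : BsVectors n K) (l : List (Fin n × Fin n)) :
    ∀ (j₀ : Fin n) (l₀ : Fin n × Fin n) (j : List (Fin n)),
      (l₀ :: l).IsChain (fun p q => p.1 = q.1 ↔ p.2 = q.2) → ∃ κ : ℂ,
        (List.zipWith (fun j i => (ℂ ∙ V.e j i).starProjection) (j₀ :: j)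
          ((l₀ :: l).map Prod.fst)).prod V.v = κ • V.e j₀ l₀.1 ∧
        (List.zipWith (fun j i => (ℂ ∙ V.e j i).starProjection) (j₀ :: j)
          ((l₀ :: l).map Prod.snd)).prod V.v = κ • V.e j₀ l₀.2 := by
  have hbase : ∀ (j₀ : Fin n) (l₀ : Fin n × Fin n), ∃ κ : ℂ,
      (ℂ ∙ V.e j₀ l₀.1).starProjection V.v = κ • V.e j₀ l₀.1 ∧
      (ℂ ∙ V.e j₀ l₀.2).starProjection V.v = κ • V.e j₀ l₀.2 := by
    intro j₀ l₀
    refine ⟨_, starProjection_singleton_apply _ _, ?_⟩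
    rw [starProjection_singleton_apply, V.gram_v j₀ l₀.1 l₀.2, V.norm_sq_eq j₀ l₀.1 l₀.2]
  induction l with
  | nil =>
    intro j₀ l₀ j _
    simpa using hbase j₀ l₀
  | cons l₁ l ih =>
    intro j₀ l₀ j hc
    cases j with
    | nil => simpa using hbase j₀ l₀
    | cons j₁ j =>
      rw [List.isChain_cons_cons] at hc
      obtain ⟨κ, h1, h2⟩ := ih j₁ l₁ j hc.2
      refine ⟨κ * (⟪V.e j₀ l₀.1, V.e j₁ l₁.1⟫_ℂ / ((‖V.e j₀ l₀.1‖ ^ 2 : ℝ) : ℂ)), ?_, ?_⟩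
      · rw [List.map_cons, List.zipWith_cons_cons, List.prod_cons]
        change (ℂ ∙ V.e j₀ l₀.1).starProjection ((List.zipWith
          (fun j i => (ℂ ∙ V.e j i).starProjection) (j₁ :: j)
          ((l₁ :: l).map Prod.fst)).prod V.v) = _
        rw [h1, map_smul, starProjection_singleton_apply, smul_smul]
      · rw [List.map_cons, List.zipWith_cons_cons, List.prod_cons]
        change (ℂ ∙ V.e j₀ l₀.2).starProjection ((List.zipWith
          (fun j i => (ℂ ∙ V.e j i).starProjection) (j₁ :: j)
          ((l₁ :: l).map Prod.snd)).prod V.v) = _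
        rw [h2, map_smul, starProjection_singleton_apply, smul_smul, V.gram _ _ _ _ _ _ hc.1,
          V.norm_sq_eq j₀ l₀.1 l₀.2]

theorem BsVectors.inner_prod_eq (V : BsVectors n K) (j : List (Fin n))
    {l : List (Fin n × Fin n)} (hl : l.IsChain (fun p q => p.1 = q.1 ↔ p.2 = q.2)) :
    ⟪V.v, (List.zipWith (fun j i => (ℂ ∙ V.e j i).starProjection) j
      (l.map Prod.fst)).prod V.v⟫_ℂ =
    ⟪V.v, (List.zipWith (fun j i => (ℂ ∙ V.e j i).starProjection) j
      (l.map Prod.snd)).prod V.v⟫_ℂ := by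
  cases l with
  | nil => simp
  | cons l₀ l =>
    cases j with
    | nil => simp
    | cons j₀ j =>
      obtain ⟨κ, h1, h2⟩ := V.exists_prod_apply l j₀ l₀ j hl
      rw [h1, h2, inner_smul_right, inner_smul_right, ← inner_conj_symm, V.gram_v j₀ l₀.1 l₀.2,
        inner_conj_symm]

/-- The vectors `m + (n δ_{a,j} - 1) (n δ_{b,i} - 1)` in `ℂ^n ⊗ ℂ^n`, for `n = m ^ 2 + 1`. -/
theorem exists_bsVectors (m : ℕ) (hm : 0 < m) :
    Nonempty (BsVectors (m ^ 2 + 1)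
      (EuclideanSpace ℂ (Fin (m ^ 2 + 1) × Fin (m ^ 2 + 1)))) := by
  set n := m ^ 2 + 1 with hn
  set N : ℂ := (Nat.cast n : ℂ) with hN
  -- The choice n = m ^ 2 + 1 makes the constant part contribute n ^ 2 (n - 1) to inner products,
  -- which cancels the mixed product (n ^ 2 - n)(-n) when exactly one index agrees.
  have hNm : (m : ℂ) ^ 2 = N - 1 := by rw [hN, hn]; push_cast; ring
  have hm0 : (m : ℂ) ≠ 0 := by exact_mod_cast hm.ne'
  have hN0 : N ≠ 0 := by rw [hN]; exact_mod_cast (by omega : n ≠ 0)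
  have hN1 : N - 1 ≠ 0 := by rw [← hNm]; exact pow_ne_zero 2 hm0
  let f : Fin n → Fin n → ℂ := fun j a => N * (if a = j then 1 else 0) - 1
  have hf_conj : ∀ j a, (starRingEnd ℂ) (f j a) = f j a := by
    intro j a
    simp only [f, hN]
    split_ifs <;> simp
  have hf_sum : ∀ j, ∑ a, f j a = 0 := by
    intro j
    simp only [f, Finset.sum_sub_distrib, ← Finset.mul_sum, Finset.sum_ite_eq', Finset.mem_univ,
      if_true, Finset.sum_const, Finset.card_univ, Fintype.card_fin, nsmul_eq_mul]
    ring
  have hf_mul : ∀ j k, ∑ a, f j a * f k a = N ^ 2 * (if j = k then 1 else 0) - N := by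
    intro j k
    have : ∀ a, f j a * f k a = N ^ 2 * (if a = j then (if j = k then 1 else 0) else 0)
        - N * (if a = j then 1 else 0) - N * (if a = k then 1 else 0) + 1 := by
      intro a
      simp only [f]
      by_cases h1 : a = j
      · subst h1
        by_cases h2 : a = k
        · simp [h2]; ring
        · simp [h2]; ring
      · simp [h1]; ring
    simp only [this, Finset.sum_add_distrib, Finset.sum_sub_distrib, ← Finset.mul_sum,
      Finset.sum_ite_eq', Finset.mem_univ, if_true, Finset.sum_const, Finset.card_univ,
      Fintype.card_fin, nsmul_eq_mul]
    ring
  let e : Fin n → Fin n → EuclideanSpace ℂ (Fin n × Fin n) := fun j i =>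
    WithLp.toLp 2 fun p => (m : ℂ) + f j p.1 * f i p.2
  let v : EuclideanSpace ℂ (Fin n × Fin n) := WithLp.toLp 2 fun _ => (1 : ℂ)
  have hee : ∀ j i k l, ⟪e j i, e k l⟫_ℂ = N ^ 2 * (N - 1) +
      (N ^ 2 * (if j = k then 1 else 0) - N) * (N ^ 2 * (if i = l then 1 else 0) - N) := by
    intro j i k l
    have h1 : ⟪e j i, e k l⟫_ℂ = ∑ a, ∑ b,
        ((m : ℂ) + f k a * f l b) * ((m : ℂ) + f j a * f i b) := by
      rw [PiLp.inner_apply, Fintype.sum_prod_type]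
      simp only [e, RCLike.inner_apply, map_add, map_mul, hf_conj, Complex.conj_natCast]
    have h2 : ∀ a b, ((m : ℂ) + f k a * f l b) * ((m : ℂ) + f j a * f i b) =
        (N - 1) + (m * f j a) * f i b + (m * f k a) * f l b + (f j a * f k a) * (f i b * f l b) := by
      intro a b
      rw [← hNm]; ring
    rw [h1]
    simp only [h2, Finset.sum_add_distrib, ← Finset.mul_sum, ← Finset.sum_mul, hf_sum, hf_mul,
      Finset.sum_const, Finset.card_univ, Fintype.card_fin, nsmul_eq_mul]
    ring
  have hev : ∀ j i, ⟪e j i, v⟫_ℂ = m * N ^ 2 := by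
    intro j i
    rw [PiLp.inner_apply, Fintype.sum_prod_type]
    simp only [e, v, RCLike.inner_apply, map_add, map_mul, hf_conj, Complex.conj_natCast, one_mul,
      Finset.sum_add_distrib, ← Finset.mul_sum, hf_sum, Finset.sum_const, Finset.card_univ,
      Fintype.card_fin, nsmul_eq_mul, mul_zero]
    ring
  have hnorm : ∀ j i, ((‖e j i‖ ^ 2 : ℝ) : ℂ) = N ^ 3 * (N - 1) := by
    intro j i
    have := inner_self_eq_norm_sq_to_K (𝕜 := ℂ) (e j i)
    rw [hee] at this
    simp only [if_true] at this
    rw [Complex.ofReal_pow]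
    refine this.symm.trans ?_
    ring
  have hsum : ∀ i, ∑ k, e k i = ((m : ℂ) * N) • v := by
    intro i
    ext p
    have : (∑ k, e k i) p = ∑ k, e k i p := by
      simp
    rw [this]
    simp only [e, v, PiLp.smul_apply, Finset.sum_add_distrib, ← Finset.sum_mul]
    have h : ∑ k, f k p.1 = 0 := by
      rw [← hf_sum p.1]
      refine Finset.sum_congr rfl fun k _ => ?_
      simp only [f, eq_comm]
    rw [h]
    simp [hN, mul_comm]
  refine ⟨⟨e, v, fun h => ?_, ?_, ?_, ?_, ?_, ?_⟩⟩
  · have := hev 0 0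
    rw [h, inner_zero_right] at this
    exact mul_ne_zero hm0 (pow_ne_zero 2 hN0) this.symm
  · intro i k l h
    rw [hee, if_pos rfl, if_neg h]
    ring
  · intro i k l h
    rw [hee, if_pos rfl, if_neg h]
    ring
  · intro j j' i i' k k' h
    rw [hee, hee]
    simp only [h]
  · intro j i k
    rw [hev, hev]
  · intro i
    simp only [hev, hnorm, ← Finset.smul_sum, hsum, smul_smul]
    have : (m : ℂ) * N ^ 2 / (N ^ 3 * (N - 1)) * (m * N) = 1 := by
      rw [div_mul_eq_mul_div, div_eq_one_iff_eq (mul_ne_zero (pow_ne_zero 3 hN0) hN1), ← hNm]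
      ring
    rw [this, one_smul]

/-- The evaluation of the universal algebra `B_s(n)` in a realization of its relations. -/
def Bs.eval (R : BsRep n) : Bs n →ₐ[ℂ] R.carrier where
  toFun a := (show bsSubalgebra n from a).1.1 R
  map_one' := rfl
  map_mul' _ _ := rfl
  map_zero' := rfl
  map_add' _ _ := rfl
  commutes' _ := rfl

end Realization

variable {A : Type w} [Ring A] [Algebra ℂ A] {φ : A →ₗ[ℂ] ℂ} {x : ℕ → A}

theorem IsBooleanInvariant.isPatternInvariant (h : IsBooleanInvariant φ x) :
    IsPatternInvariant φ x := by
  intro l hl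
  obtain ⟨m, hm⟩ : ∃ m : ℕ, ∀ p ∈ l, p.1 < m ∧ p.2 < m := by
    obtain ⟨m₁, h₁⟩ := exists_forall_lt (l.map Prod.fst)
    obtain ⟨m₂, h₂⟩ := exists_forall_lt (l.map Prod.snd)
    refine ⟨m₁ + m₂, fun p hp => ?_⟩
    have := h₁ p.1 (List.mem_map_of_mem hp)
    have := h₂ p.2 (List.mem_map_of_mem hp)
    omega
  -- Any n exceeding all the indices will do, so n may be taken of the special form.
  obtain ⟨V⟩ := exists_bsVectors (m + 1) (Nat.succ_pos m)
  set n := (m + 1) ^ 2 + 1 with hn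
  have hmn : m < n := by rw [hn]; nlinarith
  obtain ⟨l', rfl⟩ : ∃ l' : List (Fin n × Fin n),
      l'.map (fun p => ((p.1 : ℕ), (p.2 : ℕ))) = l := by
    refine ⟨l.attach.map fun p => (⟨p.1.1, (hm p.1 p.2).1.trans hmn⟩,
      ⟨p.1.2, (hm p.1 p.2).2.trans hmn⟩), ?_⟩
    rw [List.map_map]
    exact List.attach_map_subtype_val l
  rw [List.isChain_map] at hl
  replace hl : l'.IsChain (fun p q => p.1 = q.1 ↔ p.2 = q.2) := by
    refine hl.imp fun p q hpq => ?_
    simpa [Fin.ext_iff] using hpq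
  rw [isBooleanInvariant_iff] at h
  have key : ∀ (k : ℕ) (i : List (Fin n)), i.length = k →
      φ (i.map fun k : Fin n => x k).prod * ⟪V.v, V.v⟫_ℂ =
      ∑ j : Fin k → Fin n, φ ((List.ofFn j).map fun k : Fin n => x k).prod *
        ⟪V.v, (List.zipWith (fun j i => (ℂ ∙ V.e j i).starProjection) (List.ofFn j) i).prod
          V.v⟫_ℂ := by
    rintro _ i rfl
    have hPv : (ℂ ∙ V.v).starProjection V.v = V.v :=
      Submodule.starProjection_eq_self_iff.mpr (Submodule.mem_span_singleton_self V.v)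
    let ψ : Bs n →ₗ[ℂ] ℂ := (innerₛₗ ℂ V.v) ∘ₗ
      (LinearMap.applyₗ V.v ∘ₗ ContinuousLinearMap.coeLM ℂ) ∘ₗ (Bs.eval V.rep).toLinearMap
    have hP : ψ (Bs.P n) = ⟪V.v, V.v⟫_ℂ := by
      change ⟪V.v, (ℂ ∙ V.v).starProjection V.v⟫_ℂ = _
      rw [hPv]
    have hu : ∀ j : List (Fin n), ψ (Bs.P n * (List.zipWith (Bs.u n) j i).prod * Bs.P n) =
        ⟪V.v, (List.zipWith (fun j i => (ℂ ∙ V.e j i).starProjection) j i).prod V.v⟫_ℂ := by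
      intro j
      have h1 : Bs.eval V.rep (List.zipWith (Bs.u n) j i).prod =
          (List.zipWith (fun j i => (ℂ ∙ V.e j i).starProjection) j i).prod := by
        rw [map_list_prod, List.map_zipWith]
        rfl
      rw [← h1]
      have h2 : ∀ T : EuclideanSpace ℂ (Fin n × Fin n) →L[ℂ] EuclideanSpace ℂ (Fin n × Fin n),
          ⟪V.v, (ℂ ∙ V.v).starProjection (T ((ℂ ∙ V.v).starProjection V.v))⟫_ℂ =
            ⟪V.v, T V.v⟫_ℂ := by
        intro T
        rw [hPv, ← Submodule.inner_starProjection_left_eq_right, hPv]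
      exact h2 _
    simpa only [map_smul, map_sum, hP, hu, smul_eq_mul] using congrArg ψ (h n i)
  have hv : ⟪V.v, V.v⟫_ℂ ≠ 0 := inner_self_ne_zero.mpr V.v_ne
  rw [List.map_map, List.map_map]
  refine mul_right_cancel₀ hv ?_
  have h1 := key l'.length (l'.map Prod.fst) (List.length_map _)
  have h2 := key l'.length (l'.map Prod.snd) (List.length_map _)
  rw [List.map_map] at h1 h2
  refine h1.trans (Eq.trans ?_ h2.symm)
  exact Finset.sum_congr rfl fun j _ => congrArg _ (V.inner_prod_eq _ hl)

end BooleanInvariance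

/-! ### From boolean independence to boolean invariance, by boolean cumulants. -/

section Converse

section BooleanMoments

variable {A : Type w} [Ring A] [Algebra ℂ A] {ι : Type v} [DecidableEq ι]

/-- The boolean cumulants of a sequence of moments, where `M m` is the moment of order `m + 1`. -/
def booleanCumulant (M : ℕ → A) (m : ℕ) : A :=
  M m - ∑ l : Fin m, booleanCumulant M l * M (m - 1 - l)
termination_by m
decreasing_by exact l.2

theorem eq_booleanCumulant_add (M : ℕ → A) (m : ℕ) :
    M m = booleanCumulant M m + ∑ l ∈ Finset.range m, booleanCumulant M l * M (m - 1 - l) := by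
  rw [Finset.sum_range (fun l => booleanCumulant M l * M (m - 1 - l)), booleanCumulant,
    sub_add_cancel]

/-- The sum over the interval partitions of a word `a ^ (m + 1) * w` into constant blocks that do
not split the initial power, where a block of size `k + 1` contributes `c k`. -/
def booleanMoment (c : ℕ → A) : ℕ → ι → List ι → A
  | m, _, [] => c m
  | m, a, b :: w => c m * booleanMoment c 0 b w + if a = b then booleanMoment c (m + 1) a w else 0

/-- `booleanMoment` keeps the initial power in one block; the remaining sum runs over the size l + 1
≤ m of a first block that splits it. At m = 0 only the first term is left. -/
theorem booleanMoment_add_sum (e : A →ₗ[ℂ] A) (x : ι → A) (M : ℕ → A)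
    (hM : ∀ a k, e (x a ^ (k + 1)) = M k)
    (hmul : ∀ a b k (w : List ι), a ≠ b →
      e (x a ^ (k + 1) * (x b * (w.map x).prod)) = M k * e (x b * (w.map x).prod))
    (w : List ι) : ∀ (m : ℕ) (a : ι), e (x a ^ (m + 1) * (w.map x).prod) =
      booleanMoment (booleanCumulant M) m a w +
        ∑ l ∈ Finset.range m, booleanCumulant M l * e (x a ^ (m - l) * (w.map x).prod) := by
  induction w with
  | nil =>
    intro m a
    simp only [List.map_nil, List.prod_nil, mul_one, booleanMoment]
    rw [hM, eq_booleanCumulant_add M m]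
    congr 1
    refine Finset.sum_congr rfl fun l hl => ?_
    rw [Finset.mem_range] at hl
    rw [← hM a, show m - 1 - l + 1 = m - l by omega]
  | cons b w ih =>
    intro m a
    have h0 : e (x b * (w.map x).prod) = booleanMoment (booleanCumulant M) 0 b w := by
      simpa using ih 0 b
    rw [List.map_cons, List.prod_cons, booleanMoment]
    by_cases hab : a = b
    · subst hab
      have h1 := ih (m + 1) a
      rw [Finset.sum_range_succ, show m + 1 - m = 1 by omega, pow_one, h0] at h1
      rw [if_pos rfl, ← mul_assoc, ← pow_succ, h1]
      have : ∑ l ∈ Finset.range m, booleanCumulant M l * e (x a ^ (m + 1 - l) * (w.map x).prod) =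
          ∑ l ∈ Finset.range m,
            booleanCumulant M l * e (x a ^ (m - l) * (x a * (w.map x).prod)) := by
        refine Finset.sum_congr rfl fun l hl => ?_
        rw [Finset.mem_range] at hl
        rw [← mul_assoc (x a ^ (m - l)), ← pow_succ, show m - l + 1 = m + 1 - l by omega]
      rw [this]
      abel
    · rw [if_neg hab, add_zero, hmul a b m w hab, ← h0]
      nth_rw 1 [eq_booleanCumulant_add M m]
      rw [add_mul, Finset.sum_mul]
      congr 1
      refine Finset.sum_congr rfl fun l hl => ?_
      rw [Finset.mem_range] at hl
      rw [mul_assoc, ← hmul a b _ w hab, show m - 1 - l + 1 = m - l by omega]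

end BooleanMoments

section Relations

variable {n : ℕ}

theorem Bs.u_mul_u (j i i' : Fin n) :
    Bs.u n j i * Bs.u n j i' = if i = i' then Bs.u n j i else 0 := by
  split_ifs with h
  · subst h
    exact Subtype.ext <| Subtype.ext <| funext fun R => (R.relations.isStarProjection_u j i).1
  · exact Subtype.ext <| Subtype.ext <| funext fun R => R.relations.row_orthogonal j i i' h

theorem Bs.sum_u_mul_P (i : Fin n) : ∑ k, Bs.u n k i * Bs.P n = Bs.P n := by
  refine Subtype.ext <| Subtype.ext <| funext fun R => ?_
  have h : ((∑ k, Bs.u n k i * Bs.P n : Bs n) : bsSubalgebra n).1 R =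
      ∑ k, R.u k i * R.P := map_sum (Bs.eval R) _ _
  exact h.trans (R.relations.invariant i).symm

theorem sum_ofFn_succ {α β : Type*} [Fintype α] [AddCommMonoid β] {k : ℕ} (F : List α → β) :
    ∑ j : Fin (k + 1) → α, F (List.ofFn j) = ∑ a, ∑ j : Fin k → α, F (a :: List.ofFn j) := by
  rw [← (Fin.consEquiv fun _ : Fin (k + 1) => α).sum_comp, Fintype.sum_prod_type]
  refine Finset.sum_congr rfl fun a _ => Finset.sum_congr rfl fun j _ => ?_
  simp [Fin.consEquiv, List.ofFn_succ]

variable {A : Type w} [Ring A] [Algebra ℂ A]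

/-- The recursion of `booleanMoment` matches the relations: a new block lets the right factor
collapse to 𝐏 before ∑ u_{a',a} 𝐏 = 𝐏 is used, and a continued block merges two generators of one
row. The functional g is arbitrary so that it can absorb left multiplication by c m. -/
theorem sum_booleanMoment_smul (c : ℕ → A) (w : List (Fin n)) :
    ∀ (g : A →ₗ[ℂ] ℂ) (m : ℕ) (a : Fin n),
      ∑ a', ∑ j : Fin w.length → Fin n, g (booleanMoment c m a' (List.ofFn j)) •
        (Bs.u n a' a * ((List.zipWith (Bs.u n) (List.ofFn j) w).prod * Bs.P n)) =
      g (booleanMoment c m a w) • Bs.P n := by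
  induction w with
  | nil =>
    intro g m a
    simp [booleanMoment, ← Finset.smul_sum, Bs.sum_u_mul_P]
  | cons b w ih =>
    intro g m a
    have h1 : ∑ a', ∑ b', ∑ j : Fin w.length → Fin n,
        g (c m * booleanMoment c 0 b' (List.ofFn j)) • (Bs.u n a' a * (Bs.u n b' b *
          ((List.zipWith (Bs.u n) (List.ofFn j) w).prod * Bs.P n))) =
        g (c m * booleanMoment c 0 b w) • Bs.P n := by
      have h := ih (g ∘ₗ LinearMap.mulLeft ℂ (c m)) 0 b
      simp only [LinearMap.comp_apply, LinearMap.mulLeft_apply, ← mul_smul_comm,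
        ← Finset.mul_sum] at h
      simp only [← mul_smul_comm, ← Finset.mul_sum, h]
      simp only [mul_smul_comm, ← Finset.smul_sum, Bs.sum_u_mul_P]
    have h2 : ∑ a', ∑ b', ∑ j : Fin w.length → Fin n,
        g (if a' = b' then booleanMoment c (m + 1) a' (List.ofFn j) else 0) •
          (Bs.u n a' a * (Bs.u n b' b *
            ((List.zipWith (Bs.u n) (List.ofFn j) w).prod * Bs.P n))) =
        g (if a = b then booleanMoment c (m + 1) a w else 0) • Bs.P n := by
      have h : ∀ a', ∑ b', ∑ j : Fin w.length → Fin n,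
          g (if a' = b' then booleanMoment c (m + 1) a' (List.ofFn j) else 0) •
            (Bs.u n a' a * (Bs.u n b' b *
              ((List.zipWith (Bs.u n) (List.ofFn j) w).prod * Bs.P n))) =
          ∑ j : Fin w.length → Fin n, g (booleanMoment c (m + 1) a' (List.ofFn j)) •
            ((if a = b then Bs.u n a' a else 0) *
              ((List.zipWith (Bs.u n) (List.ofFn j) w).prod * Bs.P n)) := by
        intro a'
        rw [Finset.sum_eq_single a']
        · simp only [if_true, ← mul_assoc, Bs.u_mul_u]
        · intro b' _ hb
          simp [Ne.symm hb]
        · simp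
      simp only [h]
      split_ifs with hab
      · exact ih g (m + 1) a
      · simp
    rw [booleanMoment, map_add, add_smul, ← h1, ← h2, ← Finset.sum_add_distrib]
    refine Finset.sum_congr rfl fun a' _ => ?_
    rw [← Finset.sum_add_distrib]
    refine (sum_ofFn_succ (fun j => g (booleanMoment c m a' j) •
        (Bs.u n a' a * ((List.zipWith (Bs.u n) j (b :: w)).prod * Bs.P n)))).trans ?_
    refine Finset.sum_congr rfl fun b' _ => ?_
    rw [← Finset.sum_add_distrib]
    refine Finset.sum_congr rfl fun j _ => ?_
    rw [booleanMoment, map_add, add_smul, List.zipWith_cons_cons, List.prod_cons, mul_assoc]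

end Relations

variable {A : Type w} [Ring A] [Algebra ℂ A]

theorem isBooleanInvariant_of_booleanMoment {φ : A →ₗ[ℂ] ℂ} {x : ℕ → A} (c : ℕ → A)
    (h : ∀ a w, φ (x a * (w.map x).prod) = φ (booleanMoment c 0 a w)) :
    IsBooleanInvariant φ x := by
  have hn : ∀ (n m : ℕ) (a : Fin n) (w : List (Fin n)),
      booleanMoment c m (a : ℕ) (w.map fun k : Fin n => (k : ℕ)) = booleanMoment c m a w := by
    intro n m a w
    induction w generalizing m a with
    | nil => rfl
    | cons b w ih =>
      simp only [List.map_cons, booleanMoment, ih, Fin.ext_iff]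
  rw [isBooleanInvariant_iff]
  intro n i
  have hx : ∀ (a : Fin n) (w : List (Fin n)), φ ((a :: w).map fun k : Fin n => x k).prod =
      φ (booleanMoment c 0 a w) := by
    intro a w
    have := h a (w.map fun k : Fin n => (k : ℕ))
    rw [hn, List.map_map] at this
    rw [List.map_cons, List.prod_cons]
    exact this
  cases i with
  | nil => simp [Bs.P_mul_P]
  | cons a w =>
    rw [hx]
    refine Eq.symm ((sum_ofFn_succ (fun j => φ (j.map fun k : Fin n => x k).prod •
      (Bs.P n * (List.zipWith (Bs.u n) j (a :: w)).prod * Bs.P n))).trans ?_)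
    have hs := sum_booleanMoment_smul c w φ 0 a
    simp only [← mul_smul_comm, ← Finset.mul_sum] at hs
    simp only [hx, List.zipWith_cons_cons, List.prod_cons, mul_assoc, ← mul_smul_comm,
      ← Finset.mul_sum, hs]
    rw [mul_smul_comm, Bs.P_mul_P]

/-- Every word is a product of powers with consecutive bases distinct. -/
theorem exists_powers_of_word {ι : Type v} (x : ι → A) (w : List ι) : ∀ (m : ℕ) (b : ι),
    ∃ (k : ℕ) (l : List (ι × ℕ)), ((b, k) :: l).IsChain (fun p q => p.1 ≠ q.1) ∧
      x b ^ (m + 1) * (w.map x).prod = (((b, k) :: l).map fun p => x p.1 ^ (p.2 + 1)).prod := by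
  classical
  induction w with
  | nil => exact fun m b => ⟨m, [], by simp, by simp⟩
  | cons c w ih =>
    intro m b
    by_cases hbc : b = c
    · subst hbc
      obtain ⟨k, l, hl, h⟩ := ih (m + 1) b
      refine ⟨k, l, hl, ?_⟩
      rw [← h, List.map_cons, List.prod_cons, ← mul_assoc, ← pow_succ]
    · obtain ⟨k, l, hl, h⟩ := ih 0 c
      refine ⟨m, (c, k) :: l, List.isChain_cons_cons.mpr ⟨hbc, hl⟩, ?_⟩
      rw [List.map_cons, List.prod_cons, List.map_cons, List.prod_cons, ← h, zero_add, pow_one]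

theorem BPoly.X_pow_mem_withoutConstantTerm (B : Type w) [NonUnitalRing B] [Module ℂ B] (k : ℕ) :
    BPoly.X B ^ (k + 1) ∈ BPoly.withoutConstantTerm B := by
  have h1 : (1 : BPoly B) ∈ BPoly.coefficients B := Or.inr ⟨1, one_smul _ _⟩
  refine Submodule.subset_span ⟨1, h1, List.replicate (k + 1) 1, by simp, ?_, by simp⟩
  intro b hb
  rw [List.eq_of_mem_replicate hb]
  exact h1

theorem evalAt_X_pow (B : NonUnitalSubalgebra ℂ A) (a : A) (k : ℕ) :
    evalAt B a (BPoly.X B ^ k) = a ^ k := by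
  rw [evalAt_eq_evalHom, map_pow, evalHom_X]

theorem isBooleanInvariant_of_isBooleanIndependent {φ : A →ₗ[ℂ] ℂ} {x : ℕ → A}
    {B : NonUnitalSubalgebra ℂ A} {E : A →ₗ[ℂ] B} (hφ : ∀ a, φ (E a) = φ a)
    (hid : IsIdenticallyDistributed B E x) (hind : IsBooleanIndependent B E x) :
    IsBooleanInvariant φ x := by
  set e : A →ₗ[ℂ] A := B.toSubmodule.subtype ∘ₗ E with he
  have hprod : ∀ l : List (ℕ × ℕ), l ≠ [] → l.IsChain (fun p q => p.1 ≠ q.1) →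
      e (l.map fun p => x p.1 ^ (p.2 + 1)).prod =
        (l.map fun p => e (x p.1 ^ (p.2 + 1))).prod := by
    intro l hl hc
    have := hind (l.map fun p => (p.1, BPoly.X B ^ (p.2 + 1))) (by simpa using hl)
      ((List.isChain_map _).mpr hc) (by
        intro q hq
        obtain ⟨p, -, rfl⟩ := List.mem_map.mp hq
        exact BPoly.X_pow_mem_withoutConstantTerm B p.2)
    simp only [List.map_map, Function.comp_def, evalAt_X_pow] at this
    exact this
  have hM : ∀ a k, e (x a ^ (k + 1)) = e (x 0 ^ (k + 1)) := by
    intro a k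
    have := hid a 0 (BPoly.X B ^ (k + 1))
    rw [evalAt_X_pow, evalAt_X_pow] at this
    exact congrArg Subtype.val this
  refine isBooleanInvariant_of_booleanMoment (booleanCumulant fun k => e (x 0 ^ (k + 1))) ?_
  intro a w
  -- Independence applies to alternating products of powers, so the rest of the word is grouped into
  -- maximal powers, once with and once without the leading x_a ^ (k + 1).
  have h := booleanMoment_add_sum e x (fun k => e (x 0 ^ (k + 1))) hM (fun a b k w hab => by
    obtain ⟨m, l, hl, h⟩ := exists_powers_of_word x w 0 b
    rw [zero_add, pow_one] at h
    have h1 := hprod ((a, k) :: (b, m) :: l) (by simp) (List.isChain_cons_cons.mpr ⟨hab, hl⟩)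
    rw [List.map_cons, List.prod_cons, ← h, List.map_cons, List.prod_cons,
      ← hprod _ (by simp) hl, ← h] at h1
    rw [h1, hM]) w 0 a
  rw [zero_add, pow_one, Finset.range_zero, Finset.sum_empty, add_zero] at h
  rw [← h, ← hφ]
  rfl

end Converse

end BooleanDeFinetti

end

theorem theorem7p1 {H : Type*} [NormedAddCommGroup H] [InnerProductSpace ℂ H] [CompleteSpace H]
    (S : VonNeumannAlgebra H) (φ : S.toStarSubalgebra →ₗ[ℂ] ℂ)
    (hφ : IsNormalState S φ) (hφ_nondeg : IsNondegenerate φ)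
    (x : ℕ → S.toStarSubalgebra) (hx : ∀ i, IsSelfAdjoint (x i))
    (hgen : wotClosure (NonUnitalAlgebra.adjoin ℂ (Set.range x)) = ⊤) :
    IsBooleanInvariant φ x ↔
      ∃ E : S.toStarSubalgebra →ₗ[ℂ] tailAlgebra x,
        IsConditionalExpectation (tailAlgebra x) E ∧
        (∀ a, φ (E a) = φ a) ∧
        IsNormal S (fun a => toWOT S (E a)) ∧
        IsIdenticallyDistributed (tailAlgebra x) E x ∧
        IsBooleanIndependent (tailAlgebra x) E x := by
  refine ⟨fun h => exists_conditionalExpectation hφ hφ_nondeg hx hgen h.isPatternInvariant, ?_⟩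
  rintro ⟨E, -, hE, -, hid, hind⟩
  exact isBooleanInvariant_of_isBooleanIndependent hE hid hind
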